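/- Let $\mathrm{Sol}=\mathbb R^3$ with the Riemannian metric $e^{-2z}dx^2+e^{2z}dy^2+dz^2$, for which the left-invariant fields $X=e^z\partial_x$, $Y=e^{-z}\partial_y$, $Z=\partial_z$ are orthonormal. A unit speed geodesic of $\mathrm{Sol}$ is of type A if it is a line directed by one of the fields $\pm\frac{X+Y}{\sqrt2}$, $\pm\frac{X-Y}{\sqrt2}$; of type B if it is contained in a leaf of $\{dx=0\}$ or of $\{dy=0\}$; and of type C otherwise. A closed Sol manifold is a closed smooth 3-manifold $L$ diffeomorphic to a quotient $\Lambda\backslash\mathrm{Sol}$, where $\Lambda$ is a discrete group of isometries of $\mathrm{Sol}$ acting without fixed point; a Sol metric on $L$ is a smooth Riemannian metric for which $L$ is isometric to such a quotient. A closed geodesic of $L$ (of any period $T>0$, not necessarily the minimal one) is of type A, B or C if its lifts to $\mathrm{Sol}$ are. Let $\gamma$ be a type A geodesic of $\mathrm{Sol}$, let $n$ be the image of $\gamma'$ under $(X,Y)\mapsto(X,-Y)$, and let $\xi$ be the contact plane field of the unit tangent bundle of $\mathrm{Sol}$. In the coordinates $(x,y,z,\dot x,\dot y,\dot z)$ of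 $T\,\mathrm{Sol}=\mathbb R^3\times\mathbb R^3$, put $$h_1=(n,0),\quad h_2=(Z,n),\quad h_3=(Z,2n),\quad h_4=(n,-Z).$$ This is a symplectic basis of $\xi$ along $\gamma$, with $dp\wedge dq=dh_1\wedge dh_2+dh_3\wedge dh_4$. Let $\Psi(t)\in \mathrm{Sp}(4,\mathbb R)$, $\Psi(0)=I$, be the matrix in these bases of the linearized geodesic flow along $\gamma$, and let $\Psi'=A\Psi$. The Morse–Bott index of $\gamma$ over $[0,T]$ is the (Bott–)Conley–Zehnder index of $\Psi|_{[0,T]}$ in the trivialization $(h_1,\dots,h_4)$, that is, the Conley–Zehnder index on $[0,T]$ of the solution of $V'=(A+\delta J)V$, $V(0)=I$, for all sufficiently small $\delta>0$, where $J$ is the infinitesimal positive rotation $h_1\mapsto h_2\mapsto -h_1$, $h_3\mapsto h_4\mapsto -h_3$. (When $\gamma$ lifts a closed geodesic of period $T$ of a quotient of $\mathrm{Sol}$, the frame $(h_i)$ closes up after time $T$, except possibly for those geodesics, on quotients which are not torus bundles over the circle, that are closed up by an isometry reversing the direction of $Z$: the frame is then multiplied by $-1$, and the index is understood as that of the path $\Psi|_{[0,T]}$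 in the frame along the lift.) **Proposition.** Let $L$ be a closed Sol manifold and let $\Pi$ be a finite set of free homotopy classes of closed curves in $L$. Then there exists a Sol metric on $L$ such that: 1. no element of $\Pi$ is realized by a closed geodesic of type C; 2. every closed geodesic of type A of $L$ which belongs to a class of $\Pi$, of period $T$, has Morse–Bott index $1$ over $[0,T]$. -/

import Mathlib

open scoped Manifold ContDiff

noncomputable section

namespace SolGeometry

/-! ### The Riemannian manifold Sol -/

/-- The underlying smooth manifold `ℝ³` of Sol, with coordinates `x = p 0`, `y = p 1`, `z = p 2`.
The Euclidean inner product of this type plays no role: only its smooth structure is used, and the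
Riemannian metric of Sol is `solMetric` below. -/
abbrev Sol : Type := EuclideanSpace ℝ (Fin 3)

/-- The left-invariant vector field `X = e^z ∂/∂x`. -/
def fieldX (p : Sol) : Sol := !₂[Real.exp (p 2), 0, 0]

/-- The left-invariant vector field `Y = e^{-z} ∂/∂y`. -/
def fieldY (p : Sol) : Sol := !₂[0, Real.exp (-p 2), 0]

/-- The left-invariant vector field `Z = ∂/∂z`. -/
def fieldZ (_ : Sol) : Sol := !₂[0, 0, 1]

/-- The matrix of the Sol metric `e^{-2z} dx² + e^{2z} dy² + dz²`, for which `X, Y, Z` are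
orthonormal. -/
def solGram (p : Sol) : Matrix (Fin 3) (Fin 3) ℝ :=
  Matrix.diagonal ![Real.exp (-(2 * p 2)), Real.exp (2 * p 2), 1]

/-- The Riemannian metric of Sol at `p`. -/
def solMetric (p v w : Sol) : ℝ := ∑ i, ∑ j, solGram p i j * v i * w j

/-- Isometries of Sol: diffeomorphisms which preserve the Riemannian metric. -/
def IsSolIsometry (φ : Equiv.Perm Sol) : Prop :=
  ContDiff ℝ ∞ φ ∧ ContDiff ℝ ∞ φ.symm ∧
    ∀ p v w, solMetric (φ p) (fderiv ℝ φ p v) (fderiv ℝ φ p w) = solMetric p v w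

/-! ### Geodesics of Sol -/

/-- The partial derivative `∂_l g_{ij}` of the metric coefficients. -/
def gramPartial (p : Sol) (l i j : Fin 3) : ℝ :=
  fderiv ℝ (fun q : Sol => solGram q i j) p (EuclideanSpace.single l 1)

/-- The Christoffel symbols `Γ^k_{ij}` of the Levi-Civita connection of Sol. -/
def christoffel (p : Sol) (k i j : Fin 3) : ℝ :=
  ∑ l, (1 / 2) * (solGram p)⁻¹ k l *
    (gramPartial p i j l + gramPartial p j i l - gramPartial p l i j)

/-- The geodesic vector field on `T Sol = Sol × ℝ³`, that is
`(q, v) ↦ (v, - Γ_q(v, v))`. -/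
def geodesicField (w : Sol × Sol) : Sol × Sol :=
  (w.2, WithLp.toLp 2 fun k => -∑ i, ∑ j, christoffel w.1 k i j * w.2 i * w.2 j)

/-- The curve `(γ, γ')` in `T Sol`. -/
def tangentLift (γ : ℝ → Sol) (t : ℝ) : Sol × Sol := (γ t, deriv γ t)

/-- Geodesics of Sol parametrized by arc length. -/
def IsUnitGeodesic (γ : ℝ → Sol) : Prop :=
  (∀ t, HasDerivAt (tangentLift γ) (geodesicField (tangentLift γ t)) t) ∧
    ∀ t, solMetric (γ t) (deriv γ t) (deriv γ t) = 1

/-- Type `A`: lines directed by `± (X + Y)/√2` or `± (X - Y)/√2`. -/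
def IsTypeA (γ : ℝ → Sol) : Prop :=
  IsUnitGeodesic γ ∧ ∃ a b : ℝ, (a = 1 ∨ a = -1) ∧ (b = 1 ∨ b = -1) ∧
    ∀ t, deriv γ t = (Real.sqrt 2)⁻¹ • (a • fieldX (γ t) + b • fieldY (γ t))

/-- Type `B`: geodesics contained in a leaf of `{dy = 0}` or of `{dx = 0}`. -/
def IsTypeB (γ : ℝ → Sol) : Prop :=
  IsUnitGeodesic γ ∧ ((∀ t, γ t 1 = γ 0 1) ∨ (∀ t, γ t 0 = γ 0 0))

/-- Type `C`: all the other geodesics. -/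
def IsTypeC (γ : ℝ → Sol) : Prop :=
  IsUnitGeodesic γ ∧ ¬ IsTypeA γ ∧ ¬ IsTypeB γ

/-! ### Sol-manifolds and Sol-metrics -/

section Manifolds

variable {L : Type*} [TopologicalSpace L] [ChartedSpace (EuclideanSpace ℝ (Fin 3)) L]

/-- `Λ` is a discrete group of isometries of Sol acting without fixed point, and `π` is a smooth map
inducing a diffeomorphism from `Λ \ Sol` onto `L`. (For groups of isometries of Sol, discreteness
amounts to a properly discontinuous action.) -/
structure IsSolQuotient (Λ : Subgroup (Equiv.Perm Sol)) (π : Sol → L) : Prop where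
  isometry : ∀ l ∈ Λ, IsSolIsometry l
  discrete : ProperlyDiscontinuousSMul Λ Sol
  free : ∀ l ∈ Λ, ∀ p, l p = p → l = 1
  localDiffeo : IsLocalDiffeomorph (𝓡 3) (𝓡 3) ∞ π
  surjective : Function.Surjective π
  fibers : ∀ p q, π p = π q ↔ ∃ l ∈ Λ, l p = q

variable (L) in
/-- `L` is diffeomorphic to a quotient of Sol by a discrete group of isometries acting without fixed
point. -/
def IsSolManifold : Prop :=
  ∃ (Λ : Subgroup (Equiv.Perm Sol)) (π : Sol → L), IsSolQuotient Λ π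

variable [IsManifold (𝓡 3) ∞ L]

variable (L) in
/-- Smooth Riemannian metrics on `L`. -/
abbrev SmoothMetric : Type _ :=
  Bundle.ContMDiffRiemannianMetric (𝓡 3) ∞ (EuclideanSpace ℝ (Fin 3))
    (fun x : L => TangentSpace (𝓡 3) x)

/-- The Riemannian manifold `(L, g)` is the quotient of the Riemannian manifold Sol by the group
`Λ`, with projection `π`; in particular `g` is a Sol-metric. -/
def IsSolMetric (g : SmoothMetric L) (Λ : Subgroup (Equiv.Perm Sol)) (π : Sol → L) : Prop :=
  IsSolQuotient Λ π ∧
    ∀ (p : Sol) (v w : TangentSpace (𝓡 3) p),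
      g.inner (π p) (mfderiv (𝓡 3) (𝓡 3) π p v) (mfderiv (𝓡 3) (𝓡 3) π p w) = solMetric p v w

end Manifolds

/-! ### Closed curves and free homotopy classes -/

section Loops

variable {L : Type*} [TopologicalSpace L]

variable (L) in
/-- Homotopy classes of maps from the circle `ℝ/ℤ` to `L`. -/
abbrev HomotopyClass : Type _ :=
  Quotient (⟨ContinuousMap.Homotopic, ContinuousMap.Homotopic.equivalence⟩ :
    Setoid C(AddCircle (1 : ℝ), L))

/-- The curve `γ` is closed of (not necessarily minimal) period `T > 0`, and the closed curve
`γ : ℝ/Tℤ → L` belongs to the homotopy class `c`. -/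
def Realizes (γ : ℝ → L) (T : ℝ) (c : HomotopyClass L) : Prop :=
  0 < T ∧ ∃ f : C(AddCircle (1 : ℝ), L),
    (∀ s : ℝ, f (s : AddCircle (1 : ℝ)) = γ (T * s)) ∧
    (Quotient.mk _ f : HomotopyClass L) = c

end Loops

/-! ### The Conley-Zehnder index -/

section ConleyZehnder

variable {ι : Type*} [Fintype ι] [DecidableEq ι]

/-- Entrywise derivative of a path of matrices. -/
def matDeriv (Ψ : ℝ → Matrix (ι ⊕ ι) (ι ⊕ ι) ℝ) (t : ℝ) : Matrix (ι ⊕ ι) (ι ⊕ ι) ℝ :=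
  Matrix.of fun i j => deriv (fun s => Ψ s i j) t

/-- Continuously differentiable paths of symplectic matrices starting at the identity. The symplectic
form of `ℝ^{2n}` is `ω(v, w) = (J v) · w = ∑ dp_i ∧ dq_i`, where `p_i` are the first `n` coordinates and `q_i`
the last ones, so that `t ↦ exp (t J)` is a positive rotation. -/
def IsSymplecticPath (Ψ : ℝ → Matrix (ι ⊕ ι) (ι ⊕ ι) ℝ) : Prop :=
  (∀ i j, ContDiff ℝ 1 fun t => Ψ t i j) ∧ (∀ t, Ψ t ∈ Matrix.symplecticGroup ι ℝ) ∧ Ψ 0 = 1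

/-- The subspace `ker (Ψ(t) - 1)`. -/
def crossingSpace (Ψ : ℝ → Matrix (ι ⊕ ι) (ι ⊕ ι) ℝ) (t : ℝ) : Submodule ℝ (ι ⊕ ι → ℝ) :=
  LinearMap.ker (Matrix.toLin' (Ψ t - 1))

/-- The crossing form `v ↦ ω(v, Ψ'(t) v)` on `ker (Ψ(t) - 1)`. -/
def crossingForm (Ψ : ℝ → Matrix (ι ⊕ ι) (ι ⊕ ι) ℝ) (t : ℝ) :
    QuadraticForm ℝ (crossingSpace Ψ t) :=
  ((Matrix.J ι ℝ).transpose * matDeriv Ψ t).toQuadraticForm'.restrict (crossingSpace Ψ t)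

/-- The signature of the crossing form. -/
def crossingSignature (Ψ : ℝ → Matrix (ι ⊕ ι) (ι ⊕ ι) ℝ) (t : ℝ) : ℤ :=
  (sigPos (crossingForm Ψ t) : ℤ) - (sigNeg (crossingForm Ψ t) : ℤ)

/-- The crossing form at time `t` is nondegenerate. -/
def IsRegularCrossing (Ψ : ℝ → Matrix (ι ⊕ ι) (ι ⊕ ι) ℝ) (t : ℝ) : Prop :=
  ∀ v, (∀ w, QuadraticMap.polar (crossingForm Ψ t) v w = 0) → v = 0

/-- The Robbin-Salamon formula for the Conley-Zehnder index: on `[0, T]`, the path `Ψ` has only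
finitely many crossings, all regular, does not have the eigenvalue `1` at time `T`, and half the
signature at `0` plus the sum of the signatures at the crossings in `(0, T)` equals `k`. -/
def HasRegularIndex (Ψ : ℝ → Matrix (ι ⊕ ι) (ι ⊕ ι) ℝ) (T : ℝ) (k : ℤ) : Prop :=
  IsSymplecticPath Ψ ∧ crossingSpace Ψ T = ⊥ ∧
    (∀ t ∈ Set.Icc 0 T, IsRegularCrossing Ψ t) ∧
    ∃ F : Finset ℝ, (∀ t, t ∈ F ↔ t ∈ Set.Ioo 0 T ∧ crossingSpace Ψ t ≠ ⊥) ∧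
      2 * k = crossingSignature Ψ 0 + 2 * ∑ t ∈ F, crossingSignature Ψ t

/-- The Conley-Zehnder index of the path `Ψ` on `[0, T]`, with `1` not an eigenvalue of `Ψ(T)`, is
`k`: through symplectic paths starting at the identity and without eigenvalue `1` at time `T`, it is
homotopic to a path with regular crossings and index `k`. -/
def HasConleyZehnderIndex (Ψ : ℝ → Matrix (ι ⊕ ι) (ι ⊕ ι) ℝ) (T : ℝ) (k : ℤ) : Prop :=
  IsSymplecticPath Ψ ∧
    ∃ H : ℝ → ℝ → Matrix (ι ⊕ ι) (ι ⊕ ι) ℝ,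
      ContinuousOn (fun u : ℝ × ℝ => H u.1 u.2) (Set.Icc 0 1 ×ˢ Set.Icc 0 T) ∧
      (∀ s ∈ Set.Icc (0 : ℝ) 1, ∀ t ∈ Set.Icc 0 T, H s t ∈ Matrix.symplecticGroup ι ℝ) ∧
      (∀ s ∈ Set.Icc (0 : ℝ) 1, H s 0 = 1 ∧ crossingSpace (H s) T = ⊥) ∧
      (∀ t ∈ Set.Icc 0 T, H 0 t = Ψ t) ∧
      HasRegularIndex (H 1) T k

/-- The Bott version of the Conley-Zehnder index, for a symplectic path `Ψ` on `[0, T]` which may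
have the eigenvalue `1` at time `T`. If `Ψ' = A Ψ`, this is the Conley-Zehnder index of the solution
of `V' = (A + δ J) V`, `V(0) = 1`, for every small enough `δ > 0`. -/
def HasBottIndex (Ψ : ℝ → Matrix (ι ⊕ ι) (ι ⊕ ι) ℝ) (T : ℝ) (k : ℤ) : Prop :=
  IsSymplecticPath Ψ ∧
    ∃ δ₀ : ℝ, 0 < δ₀ ∧ ∀ δ ∈ Set.Ioo 0 δ₀, ∃ V : ℝ → Matrix (ι ⊕ ι) (ι ⊕ ι) ℝ,
      V 0 = 1 ∧ (∀ t, matDeriv V t = (matDeriv Ψ t * (Ψ t)⁻¹ + δ • Matrix.J ι ℝ) * V t) ∧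
      HasConleyZehnderIndex V T k

end ConleyZehnder

/-! ### Linearized geodesic flow along geodesics of type A -/

/-- The basis of the contact plane field `ξ` of the unit tangent bundle at a vector `v` of type `A`
based at `q`. For `v = (X + Y)/√2` put `n = (X - Y)/√2`, and in general let `n` be the image of `v`
under `Y ↦ -Y`. Writing `u` for the vector `(u, 0)` and `u̇` for `(0, u)` in
`T_{(q,v)} (T Sol) = ℝ³ × ℝ³`, the basis is `h₁ = n`, `h₂ = Z + ṅ`, `h₃ = Z + 2 ṅ`, `h₄ = n - Ż`.
It is symplectic: the canonical form `dp ∧ dq` is `dh₁ ∧ dh₂ + dh₃ ∧ dh₄`. The first coordinates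
`h₁, h₃` have indices `inl 0, inl 1`, their conjugates `h₂, h₄` have indices `inr 0, inr 1`. -/
def contactFrame (w : Sol × Sol) : Fin 2 ⊕ Fin 2 → Sol × Sol :=
  let n : Sol := !₂[w.2 0, -w.2 1, 0]
  let e : Sol := fieldZ w.1
  Sum.elim ![(n, 0), (e, (2 : ℝ) • n)] ![(e, n), (n, -e)]

/-- `W` is transported by the linearization of the geodesic flow along `γ`, that is, `W` solves the
variational equation of the geodesic vector field along `(γ, γ')`. -/
def IsFlowInvariant (γ : ℝ → Sol) (W : ℝ → Sol × Sol) : Prop :=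
  ∀ t, HasDerivAt W (fderiv ℝ geodesicField (tangentLift γ t) (W t)) t

/-- `Ψ(t)` is the matrix, in the bases `(h_i)` at times `0` and `t`, of the linearization on `ξ` of the
geodesic flow along the type `A` geodesic `γ`. -/
def IsLinearizedFlow (γ : ℝ → Sol) (Ψ : ℝ → Matrix (Fin 2 ⊕ Fin 2) (Fin 2 ⊕ Fin 2) ℝ) : Prop :=
  Ψ 0 = 1 ∧
    ∀ j, IsFlowInvariant γ fun t => ∑ i, Ψ t i j • contactFrame (tangentLift γ t) i

/-- The Morse-Bott index, over a period `T`, of a closed type `A` geodesic with lift `γ` to Sol: the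
Bott Conley-Zehnder index on `[0, T]`, in the trivialization `(h_i)` of `ξ` along `γ`, of the
linearized geodesic flow. -/
def HasMorseBottIndex (γ : ℝ → Sol) (T : ℝ) (k : ℤ) : Prop :=
  ∃ Ψ, IsLinearizedFlow γ Ψ ∧ HasBottIndex Ψ T k

end SolGeometry

end

/-
An isometry of Sol preserves the Killing fields, and the commuting fields `∂x`, `∂y` are
characterized up to scale among them by their arbitrarily small lengths. Hence an isometry is, up to
exchanging the roles of `x` and `y`, of the form `(x, y, z) ↦ (± e^c x + a, ± e^(-c) y + b, z + c)`.
Consequently `|ab|` is a conjugacy invariant of the horizontal translation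
`(x, y, z) ↦ (x + a, y + b, z)`: if a translation closes up a closed geodesic, then `|ab|` depends
only on the free homotopy class. Conjugating the deck group by `(x, y, z) ↦ (r x, r y, z)` yields
another quotient of Sol diffeomorphic to the first one, in which all these invariants are multiplied
by `r ^ 2`; for a finite set of classes they can thus be made as small as we like.

Along a closed geodesic of type `C` the momenta `P`, `Q` conjugate to `x`, `y` do not vanish and the
velocity oscillates, which bounds the translation invariant below; along one of type `A` the
invariant is half the square of the length. For small `r` there is thus no closed geodesic of type
`C` in the given classes, and those of type `A` are short. The index of a short geodesic of type `A`
is half the signature of the crossing form at `t = 0`, which equals `2` after the perturbation.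
-/

noncomputable section

namespace SolGeometry

/-! ### Covering maps and free homotopies -/

section Covering

variable {E X G : Type*} [TopologicalSpace E] [TopologicalSpace X] [Group G] [MulAction G E]
  {p : E → X}

theorem exists_eq_smul_of_comp_eq (hp : IsQuotientCoveringMap p G) {A : Type*}
    [TopologicalSpace A] [ConnectedSpace A] {f g : A → E} (hf : Continuous f) (hg : Continuous g)
    (hfg : ∀ a, p (f a) = p (g a)) : ∃ c : G, ∀ a, g a = c • f a := by
  have := hp.toContinuousConstSMul
  obtain ⟨a₀⟩ := ‹ConnectedSpace A›.toNonempty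
  obtain ⟨c, hc⟩ := hp.apply_eq_iff_mem_orbit.1 (hfg a₀).symm
  refine ⟨c, congrFun (hp.isCoveringMap.eq_of_comp_eq (g₂ := fun a => c • f a) hg
    (hf.const_smul c) ?_ a₀ hc.symm)⟩
  ext a
  simp [hp.map_smul, hfg a]

theorem isConj_of_homotopic (hp : IsQuotientCoveringMap p G) {γ₀ γ₁ : ℝ → E}
    (hγ₀ : Continuous γ₀) (hγ₁ : Continuous γ₁) {f₀ f₁ : C(AddCircle (1 : ℝ), X)}
    (hf : f₀.Homotopic f₁) (hf₀ : ∀ s : ℝ, f₀ s = p (γ₀ s)) (hf₁ : ∀ s : ℝ, f₁ s = p (γ₁ s))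
    {c₀ c₁ : G} (hc₀ : ∀ s, γ₀ (s + 1) = c₀ • γ₀ s) (hc₁ : ∀ s, γ₁ (s + 1) = c₁ • γ₁ s) :
    IsConj c₀ c₁ := by
  have := hp.isCancelSMul
  obtain ⟨F⟩ := hf
  let H : C(unitInterval × ℝ, X) :=
    ⟨fun a => F (a.1, (a.2 : AddCircle (1 : ℝ))), F.continuous.comp
      (continuous_fst.prodMk ((AddCircle.continuous_mk' 1).comp continuous_snd))⟩
  have hH₀ : ∀ s, H (0, s) = p (γ₀ s) := fun s => by simp [H, hf₀]
  let K := hp.isCoveringMap.liftHomotopy H ⟨γ₀, hγ₀⟩ hH₀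
  have hK : ∀ a, p (K a) = H a := fun a =>
    congrFun (hp.isCoveringMap.liftHomotopy_lifts H ⟨γ₀, hγ₀⟩ hH₀) a
  have hK₀ : ∀ s, K (0, s) = γ₀ s := fun s =>
    hp.isCoveringMap.liftHomotopy_zero H ⟨γ₀, hγ₀⟩ hH₀ s
  -- a single deck transformation closes up all the stages of the lifted homotopy
  obtain ⟨c, hc⟩ := exists_eq_smul_of_comp_eq hp (f := K) (g := fun a => K (a.1, a.2 + 1))
    K.continuous (by fun_prop) (fun a => by simp [hK, H])
  obtain ⟨d, hd⟩ := exists_eq_smul_of_comp_eq hp (f := fun s => K (1, s)) (g := γ₁)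
    (by fun_prop) hγ₁ (fun s => by simp [hK, H, hf₁])
  have hcc₀ : c = c₀ := by
    refine IsCancelSMul.right_cancel c c₀ (γ₀ 0) ?_
    rw [← hc₀, ← hK₀, ← hK₀, ← hc]
  have hdc : d * c = c₁ * d := by
    refine IsCancelSMul.right_cancel _ _ (K (1, 0)) ?_
    rw [mul_smul, mul_smul, ← hd, ← hc₁, ← hc, hd]
  exact isConj_iff.2 ⟨d, by rw [← hcc₀, hdc, mul_inv_cancel_right]⟩

end Covering

section Quotient

variable {L : Type*} [TopologicalSpace L] [ChartedSpace (EuclideanSpace ℝ (Fin 3)) L]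
  {Λ : Subgroup (Equiv.Perm Sol)} {π : Sol → L}

theorem IsSolQuotient.isQuotientCoveringMap (h : IsSolQuotient Λ π) :
    IsQuotientCoveringMap π Λ := by
  have := h.discrete
  have : ContinuousConstSMul Λ Sol := ⟨fun l => (h.isometry l l.2).1.continuous⟩
  have : IsCancelSMul Λ Sol := isCancelSMul_iff_eq_one_of_smul_eq.2
    fun l p hl => Subtype.ext (h.free l l.2 p hl)
  have hπ : Topology.IsQuotientMap π :=
    h.localDiffeo.isOpenMap.isQuotientMap h.localDiffeo.contMDiff.continuous h.surjective
  refine hπ.isQuotientCoveringMap_of_properlyDiscontinuousSMul (G := Λ) fun {p q} => ?_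
  rw [eq_comm, h.fibers]
  exact ⟨fun ⟨l, hl, e⟩ => ⟨⟨l, hl⟩, e⟩, fun ⟨l, e⟩ => ⟨l, l.2, e⟩⟩

/-- `l` is a deck transformation which closes up a lift of some loop in the free homotopy class
`c`. Such deck transformations form a conjugacy class of `Λ`. -/
def IsDeckOf (Λ : Subgroup (Equiv.Perm Sol)) (π : Sol → L) (c : HomotopyClass L)
    (l : Equiv.Perm Sol) : Prop :=
  l ∈ Λ ∧ ∃ (γ : ℝ → Sol) (f : C(AddCircle (1 : ℝ), L)), Continuous γ ∧
    (∀ s : ℝ, f s = π (γ s)) ∧ (∀ s, γ (s + 1) = l (γ s)) ∧ (Quotient.mk _ f : HomotopyClass L) = c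

theorem IsSolQuotient.exists_conj_of_isDeckOf (h : IsSolQuotient Λ π) {c : HomotopyClass L}
    {l l' : Equiv.Perm Sol} (hl : IsDeckOf Λ π c l) (hl' : IsDeckOf Λ π c l') :
    ∃ d ∈ Λ, d * l * d⁻¹ = l' := by
  obtain ⟨hlΛ, γ, f, hγ, hf, hγl, rfl⟩ := hl
  obtain ⟨hlΛ', γ', f', hγ', hf', hγl', hff'⟩ := hl'
  obtain ⟨d, hd⟩ := isConj_iff.1 <| isConj_of_homotopic h.isQuotientCoveringMap hγ hγ'
    (Quotient.exact hff'.symm) hf hf' (c₀ := ⟨l, hlΛ⟩) (c₁ := ⟨l', hlΛ'⟩) hγl hγl'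
  exact ⟨d, d.2, congrArg Subtype.val hd⟩

theorem IsSolQuotient.exists_isDeckOf (h : IsSolQuotient Λ π) {c : HomotopyClass L} {γ : ℝ → Sol}
    {T : ℝ} (hγ : Continuous γ) (hc : Realizes (fun t => π (γ t)) T c) :
    ∃ l, IsDeckOf Λ π c l ∧ ∀ t, γ (t + T) = l (γ t) := by
  obtain ⟨hT, f, hf, hfc⟩ := hc
  obtain ⟨l, hl⟩ := exists_eq_smul_of_comp_eq h.isQuotientCoveringMap
    (f := fun s => γ (T * s)) (g := fun s => γ (T * (s + 1))) (by fun_prop) (by fun_prop)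
    (fun s => by simpa using (hf s).symm.trans ((congrArg f (by simp)).trans (hf (s + 1))))
  refine ⟨l, ⟨l.2, fun s => γ (T * s), f, by fun_prop, hf, hl, hfc⟩, fun t => ?_⟩
  have hlt := hl (t / T)
  rwa [show T * (t / T + 1) = t + T by field_simp, show T * (t / T) = t by field_simp] at hlt

end Quotient

/-! ### The metric in coordinates -/

theorem solMetric_eq (p v w : Sol) : solMetric p v w =
    Real.exp (-(2 * p 2)) * v 0 * w 0 + Real.exp (2 * p 2) * v 1 * w 1 + v 2 * w 2 := by
  simp [solMetric, solGram, Fin.sum_univ_three, Matrix.diagonal_apply]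

theorem hasFDerivAt_coord (i : Fin 3) (p : Sol) :
    HasFDerivAt (fun q : Sol => q i) (EuclideanSpace.proj i : Sol →L[ℝ] ℝ) p :=
  (EuclideanSpace.proj i : Sol →L[ℝ] ℝ).hasFDerivAt

theorem hasDerivAt_iff_coord {c : ℝ → Sol} {c' : Sol} {t : ℝ} :
    HasDerivAt c c' t ↔ ∀ i, HasDerivAt (fun s => c s i) (c' i) t := by
  simp only [hasDerivAt_iff_hasFDerivAt, ← hasFDerivWithinAt_univ]
  rw [hasFDerivWithinAt_euclidean]
  refine forall_congr' fun i => ?_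
  congr! 1

theorem fderiv_coord {f : Sol → Sol} {p : Sol} (hf : DifferentiableAt ℝ f p) (v : Sol)
    (i : Fin 3) : fderiv ℝ (fun q => f q i) p v = fderiv ℝ f p v i :=
  DFunLike.congr_fun ((hasFDerivAt_coord i (f p)).comp p hf.hasFDerivAt).fderiv v

theorem fderiv_exp_coord (c : ℝ) (p v : Sol) :
    fderiv ℝ (fun q : Sol => Real.exp (c * q 2)) p v = c * Real.exp (c * p 2) * v 2 := by
  rw [(((hasFDerivAt_coord 2 p).const_mul c).exp).fderiv]
  simp [mul_left_comm, mul_assoc]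

theorem gramPartial_eq (p : Sol) (l i j : Fin 3) : gramPartial p l i j =
    if l = 2 then
      Matrix.diagonal ![-2 * Real.exp (-2 * p 2), 2 * Real.exp (2 * p 2), 0] i j else 0 := by
  by_cases hij : i = j
  · subst hij
    fin_cases i <;> simp [gramPartial, solGram, ← neg_mul, fderiv_exp_coord, eq_comm]
  · simp [gramPartial, solGram, hij]

theorem solGram_inv (p : Sol) : (solGram p)⁻¹ =
    Matrix.diagonal ![Real.exp (2 * p 2), Real.exp (-(2 * p 2)), 1] := by
  refine Matrix.inv_eq_left_inv ?_
  rw [solGram, Matrix.diagonal_mul_diagonal, ← Matrix.diagonal_one]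
  congr 1
  ext i
  fin_cases i <;> simp [← Real.exp_add]

theorem geodesicField_eq (w : Sol × Sol) : geodesicField w =
    (w.2, !₂[2 * w.2 2 * w.2 0, -(2 * w.2 2 * w.2 1),
      Real.exp (2 * w.1 2) * w.2 1 ^ 2 - Real.exp (-(2 * w.1 2)) * w.2 0 ^ 2]) := by
  have hexp : Real.exp (2 * w.1 2) * Real.exp (-(2 * w.1 2)) = 1 := by simp [← Real.exp_add]
  refine Prod.ext rfl ?_
  ext k
  fin_cases k <;>
    simp only [geodesicField, christoffel, solGram_inv, gramPartial_eq, Fin.sum_univ_three,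
      Matrix.diagonal_apply] <;> simp
  · linear_combination (2 * w.2 2 * w.2 0) * hexp
  · linear_combination (-2 * w.2 2 * w.2 1) * hexp
  · ring

/-! ### Killing fields -/

/-- The partial derivative `∂f/∂x`, `∂f/∂y` or `∂f/∂z`, according to `i`, of a function on Sol. -/
def partialD (i : Fin 3) (f : Sol → ℝ) (p : Sol) : ℝ :=
  fderiv ℝ f p (EuclideanSpace.single i 1)

theorem contDiff_partialD {f : Sol → ℝ} (hf : ContDiff ℝ ∞ f) (i : Fin 3) :
    ContDiff ℝ ∞ (partialD i f) :=
  (hf.fderiv_right (m := ∞) (by exact_mod_cast le_top)).clm_apply contDiff_const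

theorem partialD_comm {f : Sol → ℝ} (hf : ContDiff ℝ 2 f) (i j : Fin 3) :
    partialD i (partialD j f) = partialD j (partialD i f) := by
  have hf' : Differentiable ℝ (fderiv ℝ f) :=
    (hf.fderiv_right (m := 1) (by norm_num)).differentiable (by simp)
  have partialD_partialD : ∀ k l p, partialD k (partialD l f) p =
      fderiv ℝ (fderiv ℝ f) p (EuclideanSpace.single k 1) (EuclideanSpace.single l 1) := by
    intro k l p
    have := (hf' p).hasFDerivAt.clm_apply (hasFDerivAt_const (EuclideanSpace.single l (1 : ℝ)) p)
    exact (DFunLike.congr_fun this.fderiv (EuclideanSpace.single k 1)).trans (by simp)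
  ext p
  rw [partialD_partialD, partialD_partialD]
  exact hf.contDiffAt.isSymmSndFDerivAt (by simp) _ _

theorem partialD_zero (i : Fin 3) : partialD i 0 = 0 := by
  ext p
  simp [partialD]

theorem partialD_neg (i : Fin 3) (f : Sol → ℝ) :
    partialD i (fun q => -f q) = fun p => -partialD i f p := by
  ext p
  simp [partialD, fderiv_fun_neg]

theorem partialD_exp_mul {f : Sol → ℝ} (hf : Differentiable ℝ f) (i : Fin 3) (a c : ℝ) :
    partialD i (fun q => a * Real.exp (c * q 2) * f q) =
      fun p => a * Real.exp (c * p 2) * (partialD i f p + if i = 2 then c * f p else 0) := by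
  ext p
  have hexp : Differentiable ℝ fun q : Sol => Real.exp (c * q 2) := by fun_prop
  have hsingle : (EuclideanSpace.single i (1 : ℝ) : Sol) 2 = if i = 2 then 1 else 0 := by
    simp [eq_comm]
  rw [partialD, fderiv_fun_mul ((hexp p).const_mul a) (hf p), fderiv_const_mul (hexp p)]
  simp only [add_apply, smul_apply, fderiv_exp_coord, smul_eq_mul, hsingle,
    partialD]
  split_ifs <;> ring

theorem exists_affine_of_partialD {f : Sol → ℝ} (hf : Differentiable ℝ f) (c : Fin 3 → ℝ)
    (hfc : ∀ i p, partialD i f p = c i) (p : Sol) : f p = f 0 + ∑ i, c i * p i := by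
  let A : Sol →L[ℝ] ℝ := ∑ i, c i • EuclideanSpace.proj i
  have hA : ∀ q, A q = ∑ i, c i * q i := fun q => by simp [A]
  have hfA : ∀ q, fderiv ℝ (fun q => f q - A q) q = 0 := by
    intro q
    rw [fderiv_fun_sub (hf q) A.differentiableAt, A.fderiv, sub_eq_zero]
    refine ContinuousLinearMap.coe_injective ((EuclideanSpace.basisFun (Fin 3) ℝ).toBasis.ext ?_)
    intro i
    simpa [hA, partialD] using hfc i q
  have := is_const_of_fderiv_eq_zero (hf.sub A.differentiable) hfA p 0
  rwa [Pi.sub_apply, Pi.sub_apply, map_zero, sub_zero, hA, sub_eq_iff_eq_add] at this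

theorem fderiv_solMetric_comp {c U : Sol → Sol} {p : Sol} (hc : DifferentiableAt ℝ c p)
    (hU : DifferentiableAt ℝ U p) (e : Sol) :
    fderiv ℝ (fun q => solMetric (c q) (U q) (U q)) p e =
      2 * fderiv ℝ c p e 2 *
        (Real.exp (2 * c p 2) * U p 1 ^ 2 - Real.exp (-(2 * c p 2)) * U p 0 ^ 2) +
      2 * solMetric (c p) (fderiv ℝ U p e) (U p) := by
  have hcoord : ∀ {f : Sol → Sol}, DifferentiableAt ℝ f p → ∀ i,
      HasFDerivAt (fun q => f q i) (EuclideanSpace.proj i ∘L fderiv ℝ f p) p :=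
    fun hf i => (hasFDerivAt_coord i _).comp p hf.hasFDerivAt
  have hz := (hcoord hc 2).const_mul 2
  have h := (((hz.fun_neg.exp.fun_mul (hcoord hU 0)).fun_mul (hcoord hU 0)).fun_add
    ((hz.exp.fun_mul (hcoord hU 1)).fun_mul (hcoord hU 1))).fun_add
    ((hcoord hU 2).fun_mul (hcoord hU 2))
  simp only [solMetric_eq]
  rw [h.fderiv]
  simp only [add_apply, smul_apply, neg_apply, ContinuousLinearMap.comp_apply, smul_eq_mul,
    PiLp.proj_apply, EuclideanSpace.proj]
  ring

/-- Killing fields of Sol: the Lie derivative of the metric `g` along `W` vanishes, that is,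
`∂_W g(u, u) + 2 g(∂_u W, u) = 0` for all constant fields `u`. -/
structure IsKillingField (W : Sol → Sol) : Prop where
  contDiff : ContDiff ℝ ∞ W
  lieDeriv_eq_zero : ∀ q u,
    fderiv ℝ (fun p => solMetric p u u) q (W q) + 2 * solMetric q (fderiv ℝ W q u) u = 0

theorem fderiv_solMetric (p u e : Sol) : fderiv ℝ (fun q => solMetric q u u) p e =
    2 * e 2 * (Real.exp (2 * p 2) * u 1 ^ 2 - Real.exp (-(2 * p 2)) * u 0 ^ 2) := by
  rw [fderiv_solMetric_comp differentiableAt_fun_id (differentiableAt_const u) e]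
  simp [solMetric_eq]

theorem isKillingField_const {e : Sol} (he : e 2 = 0) : IsKillingField fun _ => e where
  contDiff := contDiff_const
  lieDeriv_eq_zero q u := by
    rw [fderiv_solMetric]
    simp [he, solMetric_eq]

/-- The pushforward of the vector field `W` by the diffeomorphism `φ`. -/
def pushforward (φ : Equiv.Perm Sol) (W : Sol → Sol) (q : Sol) : Sol :=
  fderiv ℝ φ (φ.symm q) (W (φ.symm q))

theorem pushforward_apply (φ : Equiv.Perm Sol) (W : Sol → Sol) (p : Sol) :
    pushforward φ W (φ p) = fderiv ℝ φ p (W p) := by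
  simp [pushforward]

namespace IsSolIsometry

variable {φ : Equiv.Perm Sol}

theorem differentiable (h : IsSolIsometry φ) : Differentiable ℝ φ :=
  h.1.differentiable (by simp)

theorem contDiff_fderiv (h : IsSolIsometry φ) : ContDiff ℝ ∞ (fderiv ℝ φ) :=
  h.1.fderiv_right (WithTop.coe_le_coe.2 le_top)

theorem fderiv_symm_apply (h : IsSolIsometry φ) (p u : Sol) :
    fderiv ℝ φ p (fderiv ℝ φ.symm (φ p) u) = u := by
  have hid : fderiv ℝ (φ ∘ φ.symm) (φ p) = ContinuousLinearMap.id ℝ Sol := by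
    rw [φ.self_comp_symm, fderiv_id]
  rw [fderiv_comp _ (h.differentiable _) (h.2.1.differentiable (by simp) _),
    φ.symm_apply_apply] at hid
  exact DFunLike.congr_fun hid u

theorem contDiff_pushforward (h : IsSolIsometry φ) {W : Sol → Sol} (hW : ContDiff ℝ ∞ W) :
    ContDiff ℝ ∞ (pushforward φ W) :=
  (h.contDiff_fderiv.comp h.2.1).clm_apply (hW.comp h.2.1)

theorem fderiv_pushforward (h : IsSolIsometry φ) {W : Sol → Sol} (hW : ContDiff ℝ ∞ W)
    (p v : Sol) : fderiv ℝ (pushforward φ W) (φ p) (fderiv ℝ φ p v) =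
      fderiv ℝ φ p (fderiv ℝ W p v) + fderiv ℝ (fderiv ℝ φ) p v (W p) := by
  have hcomp : pushforward φ W ∘ φ = fun p => fderiv ℝ φ p (W p) :=
    funext (pushforward_apply φ W)
  have hchain := fderiv_comp p ((h.contDiff_pushforward hW).differentiable (by simp) (φ p))
    (h.differentiable p)
  rw [hcomp, fderiv_clm_apply (h.contDiff_fderiv.differentiable (by simp) p)
    (hW.differentiable (by simp) p)] at hchain
  exact (DFunLike.congr_fun hchain v).symm

theorem isKillingField_pushforward (h : IsSolIsometry φ) {W : Sol → Sol} (hW : IsKillingField W) :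
    IsKillingField (pushforward φ W) where
  contDiff := h.contDiff_pushforward hW.contDiff
  lieDeriv_eq_zero q u := by
    obtain ⟨p, rfl⟩ := φ.surjective q
    obtain ⟨v, rfl⟩ : ∃ v, fderiv ℝ φ p v = u := ⟨_, h.fderiv_symm_apply p u⟩
    have hφ' := h.contDiff_fderiv.differentiable (by simp) p
    -- differentiate the invariance of the metric in the direction `W p`
    have hinv : fderiv ℝ (fun q => solMetric (φ q) (fderiv ℝ φ q v) (fderiv ℝ φ q v)) p (W p) =
        fderiv ℝ (fun q => solMetric q v v) p (W p) := by simp only [h.2.2]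
    have hsymm : fderiv ℝ (fderiv ℝ φ) p (W p) v = fderiv ℝ (fderiv ℝ φ) p v (W p) :=
      h.1.contDiffAt.isSymmSndFDerivAt (by simpa using ENat.LEInfty.out) _ _
    have hφ'v : fderiv ℝ (fun q => fderiv ℝ φ q v) p (W p) = fderiv ℝ (fderiv ℝ φ) p v (W p) := by
      rw [fderiv_clm_apply hφ' (differentiableAt_const v), ← hsymm]
      simp
    rw [fderiv_solMetric_comp (h.differentiable p) (hφ'.clm_apply (differentiableAt_const v)),
      ← fderiv_solMetric, hφ'v] at hinv
    have hadd : ∀ a b c : Sol, solMetric (φ p) (a + b) c =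
        solMetric (φ p) a c + solMetric (φ p) b c := fun a b c => by
      simp only [solMetric_eq, PiLp.add_apply]
      ring
    rw [h.fderiv_pushforward hW.contDiff, pushforward_apply, hadd, h.2.2]
    linear_combination hinv + hW.lieDeriv_eq_zero p v

end IsSolIsometry

namespace IsKillingField

variable {W : Sol → Sol}

theorem contDiff_coord (h : IsKillingField W) (i : Fin 3) : ContDiff ℝ ∞ (W · i) :=
  contDiff_euclidean.1 h.contDiff i

theorem contDiff_partialD_coord (h : IsKillingField W) (i j : Fin 3) :
    ContDiff ℝ ∞ (partialD j (W · i)) :=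
  contDiff_partialD (h.contDiff_coord i) j

theorem fderiv_apply (h : IsKillingField W) (q u : Sol) (i : Fin 3) :
    fderiv ℝ W q u i = ∑ j, u j * partialD j (W · i) q := by
  have hW := h.contDiff.differentiable (by simp) q
  have hu : u = ∑ j, u j • EuclideanSpace.single j (1 : ℝ) := by
    ext k
    simp [Pi.single_apply]
  rw [← fderiv_coord hW, hu, map_sum]
  simp only [map_smul, smul_eq_mul, partialD, ← hu]

theorem killing_equation (h : IsKillingField W) (q : Sol) (a b c : ℝ) :
    W q 2 * (Real.exp (2 * q 2) * b ^ 2 - Real.exp (-(2 * q 2)) * a ^ 2) +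
      Real.exp (-(2 * q 2)) * a * (a * partialD 0 (W · 0) q + b * partialD 1 (W · 0) q +
        c * partialD 2 (W · 0) q) +
      Real.exp (2 * q 2) * b * (a * partialD 0 (W · 1) q + b * partialD 1 (W · 1) q +
        c * partialD 2 (W · 1) q) +
      c * (a * partialD 0 (W · 2) q + b * partialD 1 (W · 2) q + c * partialD 2 (W · 2) q) = 0 := by
  have := h.lieDeriv_eq_zero q !₂[a, b, c]
  rw [fderiv_solMetric, solMetric_eq] at this
  simp only [h.fderiv_apply, Fin.sum_univ_three] at this
  simp at this
  linear_combination this / 2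

theorem partialD_zero_coord_zero (h : IsKillingField W) : partialD 0 (W · 0) = (W · 2) := by
  ext q
  have := h.killing_equation q 1 0 0
  refine mul_left_cancel₀ (Real.exp_ne_zero (-(2 * q 2))) ?_
  linear_combination this

theorem partialD_one_coord_one (h : IsKillingField W) : partialD 1 (W · 1) = fun q => -W q 2 := by
  ext q
  have := h.killing_equation q 0 1 0
  refine mul_left_cancel₀ (Real.exp_ne_zero (2 * q 2)) ?_
  linear_combination this

theorem partialD_two_coord_two (h : IsKillingField W) : partialD 2 (W · 2) = 0 := by
  ext q
  simpa using h.killing_equation q 0 0 1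

theorem partialD_two_coord_zero (h : IsKillingField W) :
    partialD 2 (W · 0) = fun q => -1 * Real.exp (2 * q 2) * partialD 0 (W · 2) q := by
  ext q
  have hx := h.killing_equation q 1 0 0
  have hz := h.killing_equation q 0 0 1
  have hxz := h.killing_equation q 1 0 1
  have hexp : Real.exp (2 * q 2) * Real.exp (-(2 * q 2)) = 1 := by simp [← Real.exp_add]
  linear_combination Real.exp (2 * q 2) * (hxz - hx - hz) - partialD 2 (W · 0) q * hexp

theorem partialD_two_coord_one (h : IsKillingField W) :
    partialD 2 (W · 1) = fun q => -1 * Real.exp (-2 * q 2) * partialD 1 (W · 2) q := by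
  ext q
  have hy := h.killing_equation q 0 1 0
  have hz := h.killing_equation q 0 0 1
  have hyz := h.killing_equation q 0 1 1
  have hexp : Real.exp (-2 * q 2) * Real.exp (2 * q 2) = 1 := by simp [← Real.exp_add]
  linear_combination Real.exp (-2 * q 2) * (hyz - hy - hz) - partialD 2 (W · 1) q * hexp

theorem partialD_one_coord_zero (h : IsKillingField W) :
    partialD 1 (W · 0) = fun q => -1 * Real.exp (4 * q 2) * partialD 0 (W · 1) q := by
  ext q
  have hx := h.killing_equation q 1 0 0
  have hy := h.killing_equation q 0 1 0
  have hxy := h.killing_equation q 1 1 0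
  have hexp : Real.exp (2 * q 2) * Real.exp (-(2 * q 2)) = 1 := by simp [← Real.exp_add]
  have hexp4 : Real.exp (4 * q 2) = Real.exp (2 * q 2) * Real.exp (2 * q 2) := by
    rw [← Real.exp_add]
    ring_nf
  rw [hexp4]
  linear_combination Real.exp (2 * q 2) * (hxy - hx - hy) - partialD 1 (W · 0) q * hexp

theorem partialD_zero_zero_coord_two (h : IsKillingField W) :
    partialD 0 (partialD 0 (W · 2)) = 0 := by
  have hcomm := partialD_comm ((h.contDiff_coord 0).of_le (by norm_cast)) 0 2
  rw [h.partialD_two_coord_zero, h.partialD_zero_coord_zero, h.partialD_two_coord_two,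
    partialD_exp_mul ((h.contDiff_partialD_coord 2 0).differentiable (by simp))] at hcomm
  ext q
  simpa using congrFun hcomm q

theorem partialD_one_one_coord_two (h : IsKillingField W) :
    partialD 1 (partialD 1 (W · 2)) = 0 := by
  have hcomm := partialD_comm ((h.contDiff_coord 1).of_le (by norm_cast)) 1 2
  rw [h.partialD_two_coord_one, h.partialD_one_coord_one, partialD_neg, h.partialD_two_coord_two,
    partialD_exp_mul ((h.contDiff_partialD_coord 2 1).differentiable (by simp))] at hcomm
  ext q
  simpa using congrFun hcomm q

theorem partialD_zero_coord_one (h : IsKillingField W) : partialD 0 (W · 1) =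
    fun q => 1 / 2 * Real.exp (-2 * q 2) * partialD 0 (partialD 1 (W · 2)) q := by
  have hu := partialD_comm ((h.contDiff_coord 0).of_le (by norm_cast)) 1 2
  have hv := partialD_comm ((h.contDiff_coord 1).of_le (by norm_cast)) 2 0
  have hw := partialD_comm ((h.contDiff_coord 2).of_le (by norm_cast)) 1 0
  rw [h.partialD_two_coord_one,
    partialD_exp_mul ((h.contDiff_partialD_coord 2 1).differentiable (by simp))] at hv
  rw [h.partialD_two_coord_zero, h.partialD_one_coord_zero,
    partialD_exp_mul ((h.contDiff_partialD_coord 2 0).differentiable (by simp)),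
    partialD_exp_mul ((h.contDiff_partialD_coord 1 0).differentiable (by simp)), hv, hw] at hu
  ext q
  have huq := congrFun hu q
  simp only [show (1 : Fin 3) ≠ 2 by decide, show (0 : Fin 3) ≠ 2 by decide, if_true, if_false,
    add_zero] at huq
  have hexp4 : Real.exp (4 * q 2) * Real.exp (-2 * q 2) = Real.exp (2 * q 2) := by
    rw [← Real.exp_add]
    ring_nf
  refine mul_left_cancel₀ (Real.exp_ne_zero (4 * q 2)) ?_
  linear_combination huq / 4 - 1 / 4 * partialD 0 (partialD 1 (W · 2)) q * hexp4

theorem partialD_zero_coord_two (h : IsKillingField W) : partialD 0 (W · 2) = 0 := by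
  have hcomm := partialD_comm ((h.contDiff_coord 1).of_le (by norm_cast)) 0 1
  have hw := partialD_comm ((h.contDiff_partialD_coord 2 1).of_le (by norm_cast)) 1 0
  rw [h.partialD_one_coord_one, partialD_neg, h.partialD_zero_coord_one,
    partialD_exp_mul ((contDiff_partialD (h.contDiff_partialD_coord 2 1) 0).differentiable
      (by simp)), hw, h.partialD_one_one_coord_two] at hcomm
  ext q
  simpa [partialD_zero] using congrFun hcomm q

theorem partialD_one_coord_two (h : IsKillingField W) : partialD 1 (W · 2) = 0 := by
  have hcomm := partialD_comm ((h.contDiff_coord 0).of_le (by norm_cast)) 1 0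
  rw [h.partialD_zero_coord_zero, h.partialD_one_coord_zero,
    partialD_exp_mul ((h.contDiff_partialD_coord 1 0).differentiable (by simp)),
    h.partialD_zero_coord_one,
    partialD_exp_mul ((contDiff_partialD (h.contDiff_partialD_coord 2 1) 0).differentiable
      (by simp)),
    partialD_comm ((h.contDiff_coord 2).of_le (by norm_cast)) 0 1,
    partialD_comm ((h.contDiff_partialD_coord 2 0).of_le (by norm_cast)) 0 1,
    h.partialD_zero_zero_coord_two] at hcomm
  ext q
  simpa [partialD_zero] using congrFun hcomm q

theorem exists_eq (h : IsKillingField W) :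
    ∃ α β γ : ℝ, ∀ q, W q = !₂[α + γ * q 0, β - γ * q 1, γ] := by
  have haffine := fun i => exists_affine_of_partialD ((h.contDiff_coord i).differentiable (by simp))
  have hw : ∀ q, W q 2 = W 0 2 := by
    simpa using haffine 2 0 fun i q => by
      fin_cases i <;> simp [h.partialD_zero_coord_two, h.partialD_one_coord_two,
        h.partialD_two_coord_two]
  have hu := haffine 0 ![W 0 2, 0, 0] fun i q => by
    fin_cases i <;> simp [h.partialD_zero_coord_zero, h.partialD_one_coord_zero,
      h.partialD_two_coord_zero, h.partialD_zero_coord_one, h.partialD_zero_coord_two,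
      h.partialD_one_coord_two, partialD_zero, hw q]
  have hv := haffine 1 ![0, -W 0 2, 0] fun i q => by
    fin_cases i <;> simp [h.partialD_zero_coord_one, h.partialD_one_coord_one,
      h.partialD_two_coord_one, h.partialD_one_coord_two, partialD_zero, hw q]
  refine ⟨W 0 0, W 0 1, W 0 2, fun q => ?_⟩
  ext i
  fin_cases i
  · simpa [Fin.sum_univ_three] using hu q
  · simpa [Fin.sum_univ_three, sub_eq_add_neg] using hv q
  · simpa using hw q

end IsKillingField

/-! ### Isometries -/

/-- The image of `e` is a Killing field `(α + γ x, β - γ y, γ)`, and such a field takes arbitrarily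
small lengths only if `γ = 0` and `α β = 0`. -/
theorem IsSolIsometry.exists_fderiv_eq {φ : Equiv.Perm Sol} (h : IsSolIsometry φ) {e : Sol}
    (he : e 2 = 0) (hinf : ∀ ε > 0, ∃ p, solMetric p e e < ε) :
    ∃ α β : ℝ, α * β = 0 ∧ ∀ p, fderiv ℝ φ p e = !₂[α, β, 0] := by
  obtain ⟨α, β, γ, hW⟩ := (h.isKillingField_pushforward (isKillingField_const he)).exists_eq
  have hφ : ∀ p, fderiv ℝ φ p e = !₂[α + γ * φ p 0, β - γ * φ p 1, γ] := fun p => by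
    rw [← hW, pushforward_apply]
  have hnorm : ∀ p, solMetric p e e = Real.exp (-(2 * φ p 2)) * (α + γ * φ p 0) ^ 2 +
      Real.exp (2 * φ p 2) * (β - γ * φ p 1) ^ 2 + γ ^ 2 := fun p => by
    rw [← h.2.2 p e e, solMetric_eq, hφ]
    simp only [Matrix.cons_val]
    ring
  have hγ : γ = 0 := by
    by_contra hγ
    obtain ⟨p, hp⟩ := hinf (γ ^ 2) (by positivity)
    have : 0 ≤ Real.exp (-(2 * φ p 2)) * (α + γ * φ p 0) ^ 2 +
      Real.exp (2 * φ p 2) * (β - γ * φ p 1) ^ 2 := by positivity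
    linarith [hnorm p]
  subst hγ
  refine ⟨α, β, ?_, fun p => by simpa using hφ p⟩
  by_contra hαβ
  obtain ⟨p, hp⟩ := hinf (2 * |α * β|) (by positivity)
  have hamgm := two_mul_le_add_sq (Real.exp (-φ p 2) * |α|) (Real.exp (φ p 2) * |β|)
  have hexp : Real.exp (-φ p 2) * Real.exp (φ p 2) = 1 := by simp [← Real.exp_add]
  rw [mul_pow, mul_pow, sq_abs, sq_abs, ← Real.exp_nat_mul, ← Real.exp_nat_mul] at hamgm
  rw [hnorm p, abs_mul] at hp
  push_cast at hamgm
  simp only [zero_mul, add_zero, sub_zero, ← mul_neg] at hp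
  refine lt_irrefl (0 : ℝ) ?_
  linear_combination hp + hamgm - 2 * |α| * |β| * hexp

theorem contDiff_vec {f g h : Sol → ℝ} (hf : ContDiff ℝ ∞ f) (hg : ContDiff ℝ ∞ g)
    (hh : ContDiff ℝ ∞ h) : ContDiff ℝ ∞ fun p => (!₂[f p, g p, h p] : Sol) :=
  contDiff_euclidean.2 fun i => by fin_cases i <;> assumption

/-- Isometries of Sol which preserve the direction of `Z`. -/
def IsStraight (φ : Sol → Sol) : Prop :=
  ∃ α β c a b : ℝ, α ^ 2 = Real.exp (2 * c) ∧ β ^ 2 = Real.exp (-(2 * c)) ∧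
    ∀ p, φ p = !₂[α * p 0 + a, β * p 1 + b, p 2 + c]

namespace IsStraight

theorem contDiff {φ : Sol → Sol} (h : IsStraight φ) : ContDiff ℝ ∞ φ := by
  obtain ⟨α, β, c, a, b, -, -, h⟩ := h
  rw [funext h]
  exact contDiff_vec (by fun_prop) (by fun_prop) (by fun_prop)

theorem solMetric_fderiv {φ : Sol → Sol} (h : IsStraight φ) (p v w : Sol) :
    solMetric (φ p) (fderiv ℝ φ p v) (fderiv ℝ φ p w) = solMetric p v w := by
  have hd := h.contDiff.differentiable (by simp) p
  obtain ⟨α, β, c, a, b, hα, hβ, h⟩ := h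
  have hφ' : ∀ u, fderiv ℝ φ p u = !₂[α * u 0, β * u 1, u 2] := fun u => by
    ext i
    rw [← fderiv_coord hd]
    simp only [h]
    fin_cases i
    · simp [(((hasFDerivAt_coord 0 p).const_mul α).add_const a).fderiv]
    · simp [(((hasFDerivAt_coord 1 p).const_mul β).add_const b).fderiv]
    · simp [((hasFDerivAt_coord 2 p).add_const c).fderiv]
  have hx : Real.exp (-(2 * φ p 2)) * α ^ 2 = Real.exp (-(2 * p 2)) := by
    rw [hα, ← Real.exp_add, h]
    congr 1
    simp only [Matrix.cons_val]
    ring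
  have hy : Real.exp (2 * φ p 2) * β ^ 2 = Real.exp (2 * p 2) := by
    rw [hβ, ← Real.exp_add, h]
    congr 1
    simp only [Matrix.cons_val]
    ring
  rw [solMetric_eq, solMetric_eq, hφ', hφ']
  simp only [Matrix.cons_val]
  linear_combination v 0 * w 0 * hx + v 1 * w 1 * hy

theorem symm {φ : Equiv.Perm Sol} (h : IsStraight φ) : IsStraight φ.symm := by
  obtain ⟨α, β, c, a, b, hα, hβ, h⟩ := h
  have hα₀ : α ≠ 0 := by
    rintro rfl
    simp [(Real.exp_pos _).ne] at hα
  have hβ₀ : β ≠ 0 := by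
    rintro rfl
    simp [(Real.exp_pos _).ne] at hβ
  refine ⟨α⁻¹, β⁻¹, -c, -(α⁻¹ * a), -(β⁻¹ * b), ?_, ?_, fun p => ?_⟩
  · rw [inv_pow, hα, ← Real.exp_neg, mul_neg]
  · rw [inv_pow, hβ, ← Real.exp_neg, mul_neg]
  · rw [Equiv.symm_apply_eq, h]
    ext i
    fin_cases i <;> simp <;> field_simp <;> ring

theorem isSolIsometry {φ : Equiv.Perm Sol} (h : IsStraight φ) : IsSolIsometry φ :=
  ⟨h.contDiff, h.symm.contDiff, h.solMetric_fderiv⟩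

theorem mul {φ ψ : Equiv.Perm Sol} (hφ : IsStraight φ) (hψ : IsStraight ψ) :
    IsStraight (φ * ψ : Equiv.Perm Sol) := by
  obtain ⟨α, β, c, a, b, hα, hβ, hφ⟩ := hφ
  obtain ⟨α', β', c', a', b', hα', hβ', hψ⟩ := hψ
  refine ⟨α * α', β * β', c + c', α * a' + a, β * b' + b, ?_, ?_, fun p => ?_⟩
  · rw [mul_pow, hα, hα', ← Real.exp_add, mul_add]
  · rw [mul_pow, hβ, hβ', ← Real.exp_add, mul_add, neg_add]
  · rw [Equiv.Perm.mul_apply, hψ, hφ]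
    ext i
    fin_cases i <;> simp <;> ring

end IsStraight

/-- The isometry `(x, y, z) ↦ (y, x, -z)` of Sol, which reverses the direction of `Z`. -/
def swapXY : Equiv.Perm Sol where
  toFun p := !₂[p 1, p 0, -p 2]
  invFun p := !₂[p 1, p 0, -p 2]
  left_inv p := by ext i; fin_cases i <;> simp
  right_inv p := by ext i; fin_cases i <;> simp

theorem swapXY_apply (p : Sol) : swapXY p = !₂[p 1, p 0, -p 2] := rfl

theorem swapXY_mul_self : swapXY * swapXY = 1 :=
  Equiv.ext swapXY.left_inv

theorem contDiff_swapXY : ContDiff ℝ ∞ swapXY :=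
  contDiff_vec (by fun_prop) (by fun_prop) (by fun_prop)

theorem fderiv_swapXY (p v : Sol) : fderiv ℝ swapXY p v = swapXY v := by
  ext i
  rw [← fderiv_coord (contDiff_swapXY.differentiable (by simp) p)]
  simp only [swapXY_apply]
  fin_cases i
  · simp [(hasFDerivAt_coord 1 p).fderiv]
  · simp [(hasFDerivAt_coord 0 p).fderiv]
  · simp [(hasFDerivAt_coord 2 p).fderiv]

theorem isSolIsometry_swapXY : IsSolIsometry swapXY := by
  refine ⟨contDiff_swapXY, contDiff_swapXY, fun p v w => ?_⟩
  simp only [fderiv_swapXY, swapXY_apply, solMetric_eq, Matrix.cons_val, mul_neg, neg_neg]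
  ring

theorem IsSolIsometry.mul {φ ψ : Equiv.Perm Sol} (hφ : IsSolIsometry φ) (hψ : IsSolIsometry ψ) :
    IsSolIsometry (φ * ψ) := by
  refine ⟨hφ.1.comp hψ.1, hψ.2.1.comp hφ.2.1, fun p v w => ?_⟩
  rw [Equiv.Perm.coe_mul, fderiv_comp p (hφ.differentiable _) (hψ.differentiable _)]
  exact (hφ.2.2 _ _ _).trans (hψ.2.2 p v w)

theorem exists_exp_lt {ε : ℝ} (hε : 0 < ε) : ∃ z, Real.exp z < ε :=
  ((Real.tendsto_exp_atBot.eventually_lt_const hε)).exists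

theorem exists_solMetric_single_zero_lt {ε : ℝ} (hε : 0 < ε) :
    ∃ p, solMetric p (EuclideanSpace.single 0 1) (EuclideanSpace.single 0 1) < ε := by
  obtain ⟨z, hz⟩ := exists_exp_lt hε
  exact ⟨!₂[0, 0, -(z / 2)], by simpa [solMetric_eq, mul_div_cancel₀] using hz⟩

theorem exists_solMetric_single_one_lt {ε : ℝ} (hε : 0 < ε) :
    ∃ p, solMetric p (EuclideanSpace.single 1 1) (EuclideanSpace.single 1 1) < ε := by
  obtain ⟨z, hz⟩ := exists_exp_lt hε
  exact ⟨!₂[0, 0, z / 2], by simpa [solMetric_eq, mul_div_cancel₀] using hz⟩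

theorem coord_eq_of_fderiv {φ : Sol → Sol} (hφ : Differentiable ℝ φ) {i : Fin 3} (c : Fin 3 → ℝ)
    (hc : ∀ j p, fderiv ℝ φ p (EuclideanSpace.single j 1) i = c j) (p : Sol) :
    φ p i = φ 0 i + ∑ j, c j * p j :=
  exists_affine_of_partialD (fun p => (hasFDerivAt_coord i (φ p)).differentiableAt.comp p (hφ p)) c
    (fun j p => (fderiv_coord (hφ p) _ i).trans (hc j p)) p

theorem eq_add_of_exp_mul_sq_eq {f : Sol → ℝ} {α : ℝ}
    (h : ∀ p, Real.exp (-(2 * f p)) * α ^ 2 = Real.exp (-(2 * p 2))) :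
    α ^ 2 = Real.exp (2 * f 0) ∧ ∀ p, f p = p 2 + f 0 := by
  have hα : ∀ p : Sol, α ^ 2 = Real.exp (2 * (f p - p 2)) := fun p => by
    rw [mul_sub, sub_eq_add_neg, Real.exp_add, ← h p, Real.exp_neg]
    field_simp
  refine ⟨by simpa using hα 0, fun p => ?_⟩
  have hexp := Real.exp_injective ((hα p).symm.trans (hα 0))
  rw [PiLp.zero_apply] at hexp
  linarith

theorem IsSolIsometry.isStraight_of_fderiv_single_zero {φ : Equiv.Perm Sol} (h : IsSolIsometry φ)
    {α : ℝ} (hx : ∀ p, fderiv ℝ φ p (EuclideanSpace.single 0 1) = !₂[α, 0, 0]) :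
    IsStraight φ := by
  obtain ⟨α', β, -, hy⟩ := h.exists_fderiv_eq (e := EuclideanSpace.single 1 1) (by simp)
    fun ε hε => exists_solMetric_single_one_lt hε
  have hg00 : ∀ p : Sol, Real.exp (-(2 * φ p 2)) * α ^ 2 = Real.exp (-(2 * p 2)) := fun p => by
    simpa [solMetric_eq, hx, mul_assoc, ← sq] using
      h.2.2 p (EuclideanSpace.single 0 1) (EuclideanSpace.single 0 1)
  have hα : α ≠ 0 := by
    rintro rfl
    simpa using hg00 0
  obtain rfl : α' = 0 := by
    simpa [solMetric_eq, hx, hy, hα] using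
      h.2.2 0 (EuclideanSpace.single 0 1) (EuclideanSpace.single 1 1)
  have hg11 : ∀ p : Sol, Real.exp (2 * φ p 2) * β ^ 2 = Real.exp (2 * p 2) := fun p => by
    simpa [solMetric_eq, hy, mul_assoc, ← sq] using
      h.2.2 p (EuclideanSpace.single 1 1) (EuclideanSpace.single 1 1)
  have hβ : β ≠ 0 := by
    rintro rfl
    simpa using hg11 0
  have hg02 : ∀ p, fderiv ℝ φ p (EuclideanSpace.single 2 1) 0 = 0 := fun p => by
    simpa [solMetric_eq, hx, hα] using
      h.2.2 p (EuclideanSpace.single 0 1) (EuclideanSpace.single 2 1)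
  have hg12 : ∀ p, fderiv ℝ φ p (EuclideanSpace.single 2 1) 1 = 0 := fun p => by
    simpa [solMetric_eq, hy, hβ] using
      h.2.2 p (EuclideanSpace.single 1 1) (EuclideanSpace.single 2 1)
  obtain ⟨hα_sq, hz⟩ := eq_add_of_exp_mul_sq_eq hg00
  refine ⟨α, β, φ 0 2, φ 0 0, φ 0 1, hα_sq, ?_, fun p => ?_⟩
  · rw [Real.exp_neg]
    exact eq_inv_of_mul_eq_one_right (by simpa using hg11 0)
  · have hφ0 := coord_eq_of_fderiv h.differentiable (i := 0) ![α, 0, 0]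
      (fun j p => by fin_cases j <;> simp [hx, hy, hg02]) p
    have hφ1 := coord_eq_of_fderiv h.differentiable (i := 1) ![0, β, 0]
      (fun j p => by fin_cases j <;> simp [hx, hy, hg12]) p
    ext i
    fin_cases i
    · simpa [Fin.sum_univ_three, add_comm] using hφ0
    · simpa [Fin.sum_univ_three, add_comm] using hφ1
    · simpa using hz p

theorem isSolIsometry_iff {φ : Equiv.Perm Sol} :
    IsSolIsometry φ ↔ IsStraight φ ∨ IsStraight (swapXY * φ : Equiv.Perm Sol) := by
  refine ⟨fun h => ?_, fun h => h.elim IsStraight.isSolIsometry fun h => ?_⟩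
  · obtain ⟨α, β, hαβ, hx⟩ := h.exists_fderiv_eq (e := EuclideanSpace.single 0 1) (by simp)
      fun ε hε => exists_solMetric_single_zero_lt hε
    rcases mul_eq_zero.1 hαβ with rfl | rfl
    · refine .inr ((isSolIsometry_swapXY.mul h).isStraight_of_fderiv_single_zero (α := β)
        fun p => ?_)
      rw [Equiv.Perm.coe_mul, fderiv_comp p (isSolIsometry_swapXY.differentiable _)
        (h.differentiable p), ContinuousLinearMap.comp_apply, hx, fderiv_swapXY, swapXY_apply]
      simp
    · exact .inl (h.isStraight_of_fderiv_single_zero hx)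
  · simpa [← mul_assoc, swapXY_mul_self] using isSolIsometry_swapXY.mul h.isSolIsometry

theorem IsStraight.swapXY_conj {φ : Equiv.Perm Sol} (h : IsStraight φ) :
    IsStraight (swapXY * φ * swapXY : Equiv.Perm Sol) := by
  obtain ⟨α, β, c, a, b, hα, hβ, h⟩ := h
  refine ⟨β, α, -c, b, a, by rw [hβ, mul_neg], by rw [hα, mul_neg, neg_neg], fun p => ?_⟩
  simp only [Equiv.Perm.mul_apply, h, swapXY_apply, Matrix.cons_val]
  ext i
  fin_cases i <;> simp [add_comm]

theorem IsSolIsometry.isStraight_mul_self {φ : Equiv.Perm Sol} (h : IsSolIsometry φ) :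
    IsStraight (φ * φ : Equiv.Perm Sol) := by
  rcases isSolIsometry_iff.1 h with h | h
  · exact h.mul h
  · simpa [mul_assoc, ← mul_assoc swapXY swapXY, swapXY_mul_self] using h.swapXY_conj.mul h

/-- The automorphism `(x, y, z) ↦ (r x, r y, z)` of Sol. -/
def dilation (r : ℝ) (hr : r ≠ 0) : Equiv.Perm Sol where
  toFun p := !₂[r * p 0, r * p 1, p 2]
  invFun p := !₂[r⁻¹ * p 0, r⁻¹ * p 1, p 2]
  left_inv p := by ext i; fin_cases i <;> simp [hr]
  right_inv p := by ext i; fin_cases i <;> simp [hr]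

section Dilation

variable (r : ℝ) (hr : r ≠ 0)

theorem dilation_apply (p : Sol) : dilation r hr p = !₂[r * p 0, r * p 1, p 2] := rfl

theorem dilation_inv : (dilation r hr)⁻¹ = dilation r⁻¹ (inv_ne_zero hr) :=
  Equiv.ext fun _ => rfl

theorem contDiff_dilation : ContDiff ℝ ∞ (dilation r hr) :=
  contDiff_vec (by fun_prop) (by fun_prop) (by fun_prop)

theorem swapXY_mul_dilation : swapXY * dilation r hr = dilation r hr * swapXY :=
  Equiv.ext fun p => by
    simp [swapXY_apply, dilation_apply]

theorem IsStraight.dilation_conj {φ : Equiv.Perm Sol} (h : IsStraight φ) :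
    IsStraight (dilation r hr * φ * (dilation r hr)⁻¹ : Equiv.Perm Sol) := by
  obtain ⟨α, β, c, a, b, hα, hβ, h⟩ := h
  refine ⟨α, β, c, r * a, r * b, hα, hβ, fun p => ?_⟩
  rw [dilation_inv, Equiv.Perm.mul_apply, Equiv.Perm.mul_apply, h, dilation_apply, dilation_apply]
  ext i
  fin_cases i <;> simp <;> field_simp

theorem IsSolIsometry.dilation_conj {φ : Equiv.Perm Sol} (h : IsSolIsometry φ) :
    IsSolIsometry (dilation r hr * φ * (dilation r hr)⁻¹) := by
  rw [isSolIsometry_iff] at h ⊢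
  refine h.imp (IsStraight.dilation_conj r hr) fun h => ?_
  rw [← mul_assoc, ← mul_assoc, swapXY_mul_dilation, mul_assoc _ swapXY]
  exact h.dilation_conj r hr

end Dilation

/-- `φ` is the horizontal translation by `(a, b, 0)`. -/
def IsHorizontal (φ : Sol → Sol) (a b : ℝ) : Prop :=
  ∀ p, φ p = p + !₂[a, b, 0]

theorem IsStraight.abs_mul_eq_of_conj {φ τ τ' : Equiv.Perm Sol} (h : IsStraight φ)
    (hconj : φ * τ = τ' * φ) {a b a' b' : ℝ} (hτ : IsHorizontal τ a b)
    (hτ' : IsHorizontal τ' a' b') : |a * b| = |a' * b'| := by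
  obtain ⟨α, β, c, x, y, hα, hβ, h⟩ := h
  have h0 := DFunLike.congr_fun hconj 0
  rw [Equiv.Perm.mul_apply, Equiv.Perm.mul_apply, hτ' (φ 0), hτ 0, h, h] at h0
  have ha : α * a = a' := by simpa [add_comm x] using congrArg (fun p : Sol => p 0) h0
  have hb : β * b = b' := by simpa [add_comm y] using congrArg (fun p : Sol => p 1) h0
  have hαβ : α ^ 2 * β ^ 2 = 1 := by rw [hα, hβ, ← Real.exp_add, add_neg_cancel, Real.exp_zero]
  rw [← sq_eq_sq_iff_abs_eq_abs, ← ha, ← hb]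
  linear_combination -(a * b) ^ 2 * hαβ

theorem IsHorizontal.swapXY_conj {τ : Equiv.Perm Sol} {a b : ℝ} (h : IsHorizontal τ a b) :
    IsHorizontal (swapXY * τ * swapXY : Equiv.Perm Sol) b a := fun p => by
  ext i
  fin_cases i <;> simp [h _, swapXY_apply]

theorem IsSolIsometry.abs_mul_eq_of_conj {φ τ τ' : Equiv.Perm Sol} (h : IsSolIsometry φ)
    (hconj : φ * τ = τ' * φ) {a b a' b' : ℝ} (hτ : IsHorizontal τ a b)
    (hτ' : IsHorizontal τ' a' b') : |a * b| = |a' * b'| := by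
  rcases isSolIsometry_iff.1 h with h | h
  · exact h.abs_mul_eq_of_conj hconj hτ hτ'
  · rw [mul_comm a' b']
    refine h.abs_mul_eq_of_conj ?_ hτ hτ'.swapXY_conj
    rw [mul_assoc, hconj, mul_assoc _ swapXY, ← mul_assoc swapXY swapXY, swapXY_mul_self, one_mul,
      mul_assoc]

/-! ### Geodesics -/

theorem eq_of_hasDerivAt_zero {f : ℝ → ℝ} (hf : ∀ t, HasDerivAt f 0 t) (s t : ℝ) : f s = f t :=
  is_const_of_deriv_eq_zero (fun t => (hf t).differentiableAt) (fun t => (hf t).deriv) s t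

theorem eq_zero_of_add_eq_of_abs_le {f : ℝ → ℝ} {T c C : ℝ} (hf : ∀ t, f (t + T) = f t + c)
    (hC : ∀ t, |f t| ≤ C) : c = 0 := by
  have hn : ∀ n : ℕ, f (n * T) = f 0 + n * c := fun n => by
    induction n with
    | zero => simp
    | succ n ih =>
      push_cast
      rw [add_one_mul, hf, ih]
      ring
  by_contra hc
  obtain ⟨n, hlt⟩ := exists_nat_gt (2 * C / |c|)
  rw [div_lt_iff₀ (abs_pos.2 hc), ← Nat.abs_cast, ← abs_mul,
    show (n : ℝ) * c = f (n * T) - f 0 by rw [hn]; ring] at hlt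
  linarith [abs_sub (f (n * T)) (f 0), hC (n * T), hC 0]

/-- The square of the component of `γ'` along `X`. -/
def energyX (γ : ℝ → Sol) (t : ℝ) : ℝ := Real.exp (-(2 * γ t 2)) * deriv γ t 0 ^ 2

/-- The square of the component of `γ'` along `Y`. -/
def energyY (γ : ℝ → Sol) (t : ℝ) : ℝ := Real.exp (2 * γ t 2) * deriv γ t 1 ^ 2

/-- The unit speed geodesic `γ` has momenta `P` and `Q` conjugate to the coordinates `x` and `y`. -/
structure HasMomenta (γ : ℝ → Sol) (P Q : ℝ) : Prop where
  isUnitGeodesic : IsUnitGeodesic γ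
  deriv_zero : ∀ t, deriv γ t 0 = P * Real.exp (2 * γ t 2)
  deriv_one : ∀ t, deriv γ t 1 = Q * Real.exp (-(2 * γ t 2))

section Geodesics

variable {γ : ℝ → Sol} {P Q : ℝ}

theorem energyX_nonneg (γ : ℝ → Sol) (t : ℝ) : 0 ≤ energyX γ t := by
  unfold energyX
  positivity

theorem energyY_nonneg (γ : ℝ → Sol) (t : ℝ) : 0 ≤ energyY γ t := by
  unfold energyY
  positivity

namespace IsUnitGeodesic

theorem hasDerivAt (h : IsUnitGeodesic γ) (t : ℝ) : HasDerivAt γ (deriv γ t) t :=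
  (ContinuousLinearMap.fst ℝ Sol Sol).hasFDerivAt.comp_hasDerivAt t (h.1 t)

theorem hasDerivAt_coord (h : IsUnitGeodesic γ) (i : Fin 3) (t : ℝ) :
    HasDerivAt (fun s => γ s i) (deriv γ t i) t :=
  hasDerivAt_iff_coord.1 (h.hasDerivAt t) i

theorem continuous (h : IsUnitGeodesic γ) : Continuous γ :=
  continuous_iff_continuousAt.2 fun t => (h.hasDerivAt t).continuousAt

theorem hasDerivAt_deriv (h : IsUnitGeodesic γ) (t : ℝ) :
    HasDerivAt (deriv γ) !₂[2 * deriv γ t 2 * deriv γ t 0, -(2 * deriv γ t 2 * deriv γ t 1),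
      energyY γ t - energyX γ t] t := by
  have hsnd := (ContinuousLinearMap.snd ℝ Sol Sol).hasFDerivAt.comp_hasDerivAt t (h.1 t)
  rw [geodesicField_eq] at hsnd
  exact hsnd

theorem hasDerivAt_deriv_zero (h : IsUnitGeodesic γ) (t : ℝ) :
    HasDerivAt (fun s => deriv γ s 0) (2 * deriv γ t 2 * deriv γ t 0) t :=
  hasDerivAt_iff_coord.1 (h.hasDerivAt_deriv t) 0

theorem hasDerivAt_deriv_one (h : IsUnitGeodesic γ) (t : ℝ) :
    HasDerivAt (fun s => deriv γ s 1) (-(2 * deriv γ t 2 * deriv γ t 1)) t :=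
  hasDerivAt_iff_coord.1 (h.hasDerivAt_deriv t) 1

theorem hasDerivAt_deriv_two (h : IsUnitGeodesic γ) (t : ℝ) :
    HasDerivAt (fun s => deriv γ s 2) (energyY γ t - energyX γ t) t :=
  hasDerivAt_iff_coord.1 (h.hasDerivAt_deriv t) 2

theorem hasDerivAt_exp (h : IsUnitGeodesic γ) (t : ℝ) : HasDerivAt (fun s => Real.exp (2 * γ s 2))
    (Real.exp (2 * γ t 2) * (2 * deriv γ t 2)) t :=
  ((h.hasDerivAt_coord 2 t).const_mul 2).exp

theorem hasDerivAt_exp_neg (h : IsUnitGeodesic γ) (t : ℝ) :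
    HasDerivAt (fun s => Real.exp (-(2 * γ s 2)))
      (Real.exp (-(2 * γ t 2)) * -(2 * deriv γ t 2)) t :=
  ((h.hasDerivAt_coord 2 t).const_mul 2).fun_neg.exp

theorem hasDerivAt_energyX (h : IsUnitGeodesic γ) (t : ℝ) :
    HasDerivAt (energyX γ) (2 * deriv γ t 2 * energyX γ t) t :=
  ((h.hasDerivAt_exp_neg t).mul ((h.hasDerivAt_deriv_zero t).pow 2)).congr_deriv (by
    simp only [energyX, Pi.pow_apply]
    ring)

theorem hasDerivAt_energyY (h : IsUnitGeodesic γ) (t : ℝ) :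
    HasDerivAt (energyY γ) (-(2 * deriv γ t 2 * energyY γ t)) t :=
  ((h.hasDerivAt_exp t).mul ((h.hasDerivAt_deriv_one t).pow 2)).congr_deriv (by
    simp only [energyY, Pi.pow_apply]
    ring)

theorem energy_add_eq_one (h : IsUnitGeodesic γ) (t : ℝ) :
    energyX γ t + energyY γ t + deriv γ t 2 ^ 2 = 1 := by
  rw [← h.2 t, solMetric_eq, energyX, energyY]
  ring

theorem exists_hasMomenta (h : IsUnitGeodesic γ) : ∃ P Q, HasMomenta γ P Q := by
  have hP : ∀ t, HasDerivAt (fun s => deriv γ s 0 * Real.exp (-(2 * γ s 2))) 0 t := fun t =>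
    ((h.hasDerivAt_deriv_zero t).mul (h.hasDerivAt_exp_neg t)).congr_deriv (by ring)
  have hQ : ∀ t, HasDerivAt (fun s => deriv γ s 1 * Real.exp (2 * γ s 2)) 0 t := fun t =>
    ((h.hasDerivAt_deriv_one t).mul (h.hasDerivAt_exp t)).congr_deriv (by ring)
  refine ⟨deriv γ 0 0 * Real.exp (-(2 * γ 0 2)), deriv γ 0 1 * Real.exp (2 * γ 0 2), h,
    fun t => ?_, fun t => ?_⟩
  · have hconst := eq_of_hasDerivAt_zero hP 0 t
    rw [hconst, mul_assoc, ← Real.exp_add, neg_add_cancel, Real.exp_zero, mul_one]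
  · have hconst := eq_of_hasDerivAt_zero hQ 0 t
    rw [hconst, mul_assoc, ← Real.exp_add, add_neg_cancel, Real.exp_zero, mul_one]

end IsUnitGeodesic

namespace HasMomenta

theorem energyX_eq (h : HasMomenta γ P Q) (t : ℝ) :
    energyX γ t = P ^ 2 * Real.exp (2 * γ t 2) := by
  rw [energyX, h.deriv_zero, Real.exp_neg]
  field_simp

theorem energyY_eq (h : HasMomenta γ P Q) (t : ℝ) :
    energyY γ t = Q ^ 2 * Real.exp (-(2 * γ t 2)) := by
  rw [energyY, h.deriv_one, Real.exp_neg]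
  field_simp

theorem energyX_mul_energyY (h : HasMomenta γ P Q) (t : ℝ) :
    energyX γ t * energyY γ t = |P * Q| ^ 2 := by
  rw [h.energyX_eq, h.energyY_eq, Real.exp_neg, sq_abs]
  field_simp

theorem hasDerivAt_mul_zero (h : HasMomenta γ P Q) (t : ℝ) :
    HasDerivAt (fun s => P * γ s 0) (energyX γ t) t :=
  ((h.isUnitGeodesic.hasDerivAt_coord 0 t).const_mul P).congr_deriv (by
    rw [h.deriv_zero, h.energyX_eq]
    ring)

theorem hasDerivAt_mul_one (h : HasMomenta γ P Q) (t : ℝ) :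
    HasDerivAt (fun s => Q * γ s 1) (energyY γ t) t :=
  ((h.isUnitGeodesic.hasDerivAt_coord 1 t).const_mul Q).congr_deriv (by
    rw [h.deriv_one, h.energyY_eq]
    ring)

theorem exists_abs_le (h : HasMomenta γ P Q) (hP : P ≠ 0) (hQ : Q ≠ 0) :
    ∃ C, ∀ t, |γ t 2| ≤ C := by
  refine ⟨max (-(Real.log (P ^ 2) / 2)) (-(Real.log (Q ^ 2) / 2)), fun t => abs_le'.2 ⟨?_, ?_⟩⟩
  · refine le_max_of_le_left ?_
    have hA : energyX γ t ≤ 1 := by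
      nlinarith [h.isUnitGeodesic.energy_add_eq_one t, energyY_nonneg γ t]
    rw [h.energyX_eq] at hA
    have hlog := Real.log_le_log (by positivity) hA
    rw [Real.log_mul (by positivity) (by positivity), Real.log_exp, Real.log_one] at hlog
    linarith
  · refine le_max_of_le_right ?_
    have hB : energyY γ t ≤ 1 := by
      nlinarith [h.isUnitGeodesic.energy_add_eq_one t, energyX_nonneg γ t]
    rw [h.energyY_eq] at hB
    have hlog := Real.log_le_log (by positivity) hB
    rw [Real.log_mul (by positivity) (by positivity), Real.log_exp, Real.log_one] at hlog
    linarith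

theorem exists_isHorizontal (h : HasMomenta γ P Q) (hP : P ≠ 0) (hQ : Q ≠ 0) {φ : Sol → Sol}
    (hφ : IsStraight φ) {T : ℝ} (hT : ∀ t, γ (t + T) = φ (γ t)) : ∃ a b, IsHorizontal φ a b := by
  obtain ⟨α, β, c, a, b, -, -, hφ⟩ := hφ
  have hT' : ∀ t, γ (t + T) = !₂[α * γ t 0 + a, β * γ t 1 + b, γ t 2 + c] := fun t => by
    rw [hT, hφ]
  obtain ⟨C, hC⟩ := h.exists_abs_le hP hQ
  obtain rfl : c = 0 := eq_zero_of_add_eq_of_abs_le (T := T) (fun t => by simp [hT']) hC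
  have hz : γ T 2 = γ 0 2 := by simpa using congrArg (fun p : Sol => p 2) (hT' 0)
  have hderiv : ∀ i, HasDerivAt (fun s => γ (s + T) i) (deriv γ T i) 0 := fun i => by
    simpa using (h.isUnitGeodesic.hasDerivAt_coord i (0 + T)).comp_add_const 0 T
  simp only [hT'] at hderiv
  obtain rfl : α = 1 := by
    have hα := (hderiv 0).unique
      (((h.isUnitGeodesic.hasDerivAt_coord 0 0).const_mul α).add_const a)
    rw [h.deriv_zero, h.deriv_zero, hz] at hα
    exact (mul_eq_right₀ (mul_ne_zero hP (Real.exp_ne_zero _))).1 hα.symm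
  obtain rfl : β = 1 := by
    have hβ := (hderiv 1).unique
      (((h.isUnitGeodesic.hasDerivAt_coord 1 0).const_mul β).add_const b)
    rw [h.deriv_one, h.deriv_one, hz] at hβ
    exact (mul_eq_right₀ (mul_ne_zero hQ (Real.exp_ne_zero _))).1 hβ.symm
  refine ⟨a, b, fun p => ?_⟩
  rw [hφ]
  ext i
  fin_cases i <;> simp

end HasMomenta

/-! ### Closing up geodesics of type A -/

namespace IsTypeA

theorem deriv_two (h : IsTypeA γ) (t : ℝ) : deriv γ t 2 = 0 := by
  obtain ⟨-, a, b, -, -, h⟩ := h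
  rw [h]
  simp [fieldX, fieldY]

theorem energyX_eq (h : IsTypeA γ) (t : ℝ) : energyX γ t = 1 / 2 := by
  obtain ⟨-, a, b, ha, -, h⟩ := h
  have ha' : a ^ 2 = 1 := by rcases ha with rfl | rfl <;> norm_num
  have hderiv : deriv γ t 0 = (√2)⁻¹ * (a * Real.exp (γ t 2)) := by
    rw [h]
    simp [fieldX, fieldY]
  rw [energyX, hderiv, mul_pow, mul_pow, ha', ← Real.exp_nat_mul, inv_pow,
    Real.sq_sqrt zero_le_two, Real.exp_neg]
  push_cast
  field_simp

theorem energyY_eq (h : IsTypeA γ) (t : ℝ) : energyY γ t = 1 / 2 := by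
  have hunit := h.1.energy_add_eq_one t
  rw [h.energyX_eq, h.deriv_two] at hunit
  linarith

/-- A geodesic of type `A` travels half of its length along `X` and half of it along `Y`. -/
theorem abs_mul_eq (h : IsTypeA γ) {φ : Sol → Sol} (hφ : IsStraight φ) {T : ℝ}
    (hT : ∀ t, γ (t + T) = φ (γ t)) : ∃ a b, IsHorizontal φ a b ∧ |a * b| = T ^ 2 / 2 := by
  obtain ⟨P, Q, hPQ⟩ := h.1.exists_hasMomenta
  have hmul : |P * Q| = 1 / 2 := by
    have hsq := hPQ.energyX_mul_energyY 0
    rw [h.energyX_eq, h.energyY_eq, ← sq] at hsq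
    exact ((sq_eq_sq₀ (by norm_num) (abs_nonneg _)).1 hsq).symm
  have hne : P * Q ≠ 0 := fun h0 => by norm_num [h0] at hmul
  obtain ⟨a, b, hab⟩ :=
    hPQ.exists_isHorizontal (left_ne_zero_of_mul hne) (right_ne_zero_of_mul hne) hφ hT
  refine ⟨a, b, hab, ?_⟩
  have hT' : γ T = γ 0 + !₂[a, b, 0] := by rw [← hab, ← hT, zero_add]
  have hPx : ∀ t, HasDerivAt (fun s => P * γ s 0 - s * (1 / 2)) 0 t := fun t =>
    ((hPQ.hasDerivAt_mul_zero t).sub ((hasDerivAt_id t).mul_const _)).congr_deriv (by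
      rw [h.energyX_eq, one_mul, sub_self])
  have hQy : ∀ t, HasDerivAt (fun s => Q * γ s 1 - s * (1 / 2)) 0 t := fun t =>
    ((hPQ.hasDerivAt_mul_one t).sub ((hasDerivAt_id t).mul_const _)).congr_deriv (by
      rw [h.energyY_eq, one_mul, sub_self])
  have hPa := eq_of_hasDerivAt_zero hPx T 0
  have hQb := eq_of_hasDerivAt_zero hQy T 0
  simp only [hT', PiLp.add_apply, Matrix.cons_val, zero_mul, sub_zero] at hPa hQb
  calc |a * b| = 2 * (|P * Q| * |a * b|) := by rw [hmul]; ring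
    _ = 2 * |P * a * (Q * b)| := by rw [← abs_mul]; ring_nf
    _ = 2 * |T / 2 * (T / 2)| := by
      rw [show P * a = T / 2 by linarith, show Q * b = T / 2 by linarith]
    _ = T ^ 2 / 2 := by rw [abs_mul_self]; ring

end IsTypeA

end Geodesics

/-! ### Closing up geodesics of type C -/

theorem one_le_mul_sq_of_hasDerivAt {w w₁ w₂ : ℝ → ℝ} {t₀ t₁ K : ℝ}
    (hw : ∀ t, HasDerivAt w (w₁ t) t) (hw₁ : ∀ t, HasDerivAt w₁ (w₂ t) t) (h01 : t₀ ≤ t₁)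
    (h0 : w t₀ = 0) (h1 : w₁ t₁ = 0) (hne : w t₁ ≠ 0) (hK : ∀ t, |w₂ t| ≤ K * |w t₁|) :
    1 ≤ K * (t₁ - t₀) ^ 2 := by
  have hC : 0 ≤ K * |w t₁| := (abs_nonneg _).trans (hK t₁)
  have hw₁_le : ∀ t ∈ Set.Icc t₀ t₁, ‖w₁ t‖ ≤ K * |w t₁| * (t₁ - t₀) := fun t ht => by
    have hle := convex_univ.norm_image_sub_le_of_norm_hasDerivWithin_le
      (fun x _ => (hw₁ x).hasDerivWithinAt) (fun x _ => hK x) (Set.mem_univ t₁) (Set.mem_univ t)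
    rw [h1, sub_zero, norm_sub_rev, Real.norm_of_nonneg (sub_nonneg.2 ht.2)] at hle
    exact hle.trans (mul_le_mul_of_nonneg_left (by linarith [ht.1]) hC)
  have hw_le := (convex_Icc t₀ t₁).norm_image_sub_le_of_norm_hasDerivWithin_le
    (fun x _ => (hw x).hasDerivWithinAt) hw₁_le (Set.left_mem_Icc.2 h01) (Set.right_mem_Icc.2 h01)
  rw [h0, sub_zero, Real.norm_of_nonneg (sub_nonneg.2 h01), Real.norm_eq_abs] at hw_le
  refine le_of_mul_le_mul_right ?_ (abs_pos.2 hne)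
  linarith

theorem exists_eq_zero_and_sq_le_of_periodic {f w : ℝ → ℝ} {T : ℝ} (hT : 0 < T)
    (hf : ∀ t, HasDerivAt f (w t) t) (hf_per : Function.Periodic f T) (hw : Continuous w)
    (hw_per : Function.Periodic w T) :
    ∃ t₀, ∃ t₁ ∈ Set.Icc t₀ (t₀ + T), w t₀ = 0 ∧ ∀ t, w t ^ 2 ≤ w t₁ ^ 2 := by
  obtain ⟨t₀, -, ht₀⟩ : ∃ t ∈ Set.Ioo 0 T, w t = 0 :=
    exists_hasDerivAt_eq_zero hT (fun t _ => (hf t).continuousAt.continuousWithinAt)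
      hf_per.eq.symm (fun t _ => hf t)
  obtain ⟨t₁, ht₁, hmax⟩ := isCompact_Icc.exists_isMaxOn
    (Set.nonempty_Icc.2 (le_add_of_nonneg_right hT.le)) (hw.pow 2).continuousOn
  refine ⟨t₀, t₁, ht₁, ht₀, fun t => ?_⟩
  obtain ⟨s, hs, hts⟩ := hw_per.exists_mem_Ico hT t t₀
  rw [hts]
  exact hmax ⟨hs.1, hs.2.le⟩

theorem periodic_deriv_of_add_eq {E : Type*} [NormedAddCommGroup E] [NormedSpace ℝ E] {f : ℝ → E}
    {T : ℝ} {c : E} (hT : ∀ t, f (t + T) = f t + c) : Function.Periodic (deriv f) T := fun t => by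
  rw [← deriv_comp_add_const, funext hT, deriv_add_const]

section TypeC

variable {γ : ℝ → Sol} {P Q : ℝ}

theorem IsUnitGeodesic.hasDerivAt_energyY_sub_energyX (h : IsUnitGeodesic γ) (t : ℝ) :
    HasDerivAt (fun s => energyY γ s - energyX γ s)
      (-(2 * deriv γ t 2 * (energyX γ t + energyY γ t))) t :=
  ((h.hasDerivAt_energyY t).sub (h.hasDerivAt_energyX t)).congr_deriv (by ring)

theorem IsUnitGeodesic.one_le_two_mul_sq (h : IsUnitGeodesic γ) {t₀ t₁ : ℝ}
    (h01 : t₀ ≤ t₁) (h0 : deriv γ t₀ 2 = 0) (hne : deriv γ t₁ 2 ≠ 0)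
    (hmax : ∀ t, deriv γ t 2 ^ 2 ≤ deriv γ t₁ 2 ^ 2) (hXY : energyY γ t₁ - energyX γ t₁ = 0) :
    1 ≤ 2 * (t₁ - t₀) ^ 2 :=
  one_le_mul_sq_of_hasDerivAt h.hasDerivAt_deriv_two h.hasDerivAt_energyY_sub_energyX h01 h0 hXY hne
    fun t => by
      have hXY_nonneg := add_nonneg (energyX_nonneg γ t) (energyY_nonneg γ t)
      rw [abs_neg, abs_mul, abs_mul, abs_of_nonneg hXY_nonneg, abs_two, mul_assoc]
      have hXY_le : energyX γ t + energyY γ t ≤ 1 := by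
        linarith [h.energy_add_eq_one t, sq_nonneg (deriv γ t 2)]
      gcongr
      exact (mul_le_of_le_one_right (abs_nonneg _) hXY_le).trans (sq_le_sq.1 (hmax t))

namespace HasMomenta

theorem isTypeA_of_deriv_two_eq_zero (h : HasMomenta γ P Q) (hw : ∀ t, deriv γ t 2 = 0) :
    IsTypeA γ := by
  have hz : ∀ t, γ t 2 = γ 0 2 := fun t => eq_of_hasDerivAt_zero
    (fun s => (h.isUnitGeodesic.hasDerivAt_coord 2 s).congr_deriv (hw s)) t 0
  have hXY : energyY γ 0 - energyX γ 0 = 0 :=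
    (h.isUnitGeodesic.hasDerivAt_deriv_two 0).unique (by simp only [hw, hasDerivAt_const])
  have hunit := h.isUnitGeodesic.energy_add_eq_one 0
  have hX : P ^ 2 * Real.exp (γ 0 2) ^ 2 = 1 / 2 := by
    rw [← Real.exp_nat_mul, Nat.cast_ofNat, ← h.energyX_eq]
    nlinarith [hw 0]
  have hY : Q ^ 2 * Real.exp (-γ 0 2) ^ 2 = 1 / 2 := by
    rw [← Real.exp_nat_mul, Nat.cast_ofNat, mul_neg, ← h.energyY_eq]
    nlinarith [hw 0]
  have hsqrt : √2 * √2 = 2 := Real.mul_self_sqrt zero_le_two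
  refine ⟨h.isUnitGeodesic, √2 * (P * Real.exp (γ 0 2)), √2 * (Q * Real.exp (-γ 0 2)),
    mul_self_eq_one_iff.1 ?_, mul_self_eq_one_iff.1 ?_, fun t => ?_⟩
  · linear_combination 2 * hX + P ^ 2 * Real.exp (γ 0 2) ^ 2 * hsqrt
  · linear_combination 2 * hY + Q ^ 2 * Real.exp (-γ 0 2) ^ 2 * hsqrt
  · ext i
    fin_cases i
    · simp [fieldX, fieldY, h.deriv_zero, hz t, two_mul, Real.exp_add, mul_assoc]
    · simp [fieldX, fieldY, h.deriv_one, hz t, two_mul, Real.exp_add, mul_assoc]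
    · simp [fieldX, fieldY, hw t]

theorem monotone_add_deriv_two (h : HasMomenta γ P Q) :
    Monotone fun t => P * γ t 0 + Q * γ t 1 + deriv γ t 2 :=
  monotone_of_hasDerivAt_nonneg
    (fun t => ((h.hasDerivAt_mul_zero t).add (h.hasDerivAt_mul_one t)).add
      (h.isUnitGeodesic.hasDerivAt_deriv_two t))
    fun t => (by linarith [energyY_nonneg γ t] :
      0 ≤ energyX γ t + energyY γ t + (energyY γ t - energyX γ t))

theorem monotone_sub_deriv_two (h : HasMomenta γ P Q) :
    Monotone fun t => P * γ t 0 + Q * γ t 1 - deriv γ t 2 :=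
  monotone_of_hasDerivAt_nonneg
    (fun t => ((h.hasDerivAt_mul_zero t).add (h.hasDerivAt_mul_one t)).sub
      (h.isUnitGeodesic.hasDerivAt_deriv_two t))
    fun t => (by linarith [energyX_nonneg γ t] :
      0 ≤ energyX γ t + energyY γ t - (energyY γ t - energyX γ t))

theorem monotone_sub_mul (h : HasMomenta γ P Q) :
    Monotone fun t => P * γ t 0 + Q * γ t 1 - 2 * |P * Q| * t :=
  monotone_of_hasDerivAt_nonneg
    (fun t => ((h.hasDerivAt_mul_zero t).add (h.hasDerivAt_mul_one t)).sub
      ((hasDerivAt_id t).const_mul (2 * |P * Q|)))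
    fun t => by
      have hsq : (2 * |P * Q|) ^ 2 ≤ (energyX γ t + energyY γ t) ^ 2 := by
        linarith [h.energyX_mul_energyY t, sq_nonneg (energyX γ t - energyY γ t)]
      simpa using le_of_abs_le
        (abs_le_of_sq_le_sq hsq (add_nonneg (energyX_nonneg γ t) (energyY_nonneg γ t)))

theorem mul_eq_of_add_eq (h : HasMomenta γ P Q) {T a b : ℝ}
    (hT : ∀ t, γ (t + T) = γ t + !₂[a, b, 0]) : P * a = Q * b := by
  have hconst : ∀ t, HasDerivAt (fun s => deriv γ s 2 + P * γ s 0 - Q * γ s 1) 0 t := fun t =>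
    (((h.isUnitGeodesic.hasDerivAt_deriv_two t).add (h.hasDerivAt_mul_zero t)).sub
      (h.hasDerivAt_mul_one t)).congr_deriv (by ring)
  have heq := eq_of_hasDerivAt_zero hconst (0 + T) 0
  simp only [periodic_deriv_of_add_eq hT 0, hT 0, PiLp.add_apply, Matrix.cons_val] at heq
  linarith

/-- Where the speed along `Z` is extremal, the components along `X` and `Y` have equal squares. -/
theorem deriv_two_sq_eq_of_sq_le (h : HasMomenta γ P Q) {t₁ : ℝ}
    (hmax : ∀ t, deriv γ t 2 ^ 2 ≤ deriv γ t₁ 2 ^ 2) (hne : deriv γ t₁ 2 ≠ 0) :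
    energyY γ t₁ - energyX γ t₁ = 0 ∧ deriv γ t₁ 2 ^ 2 = 1 - 2 * |P * Q| := by
  have hloc : IsLocalMax (fun t => deriv γ t 2 ^ 2) t₁ := Filter.Eventually.of_forall hmax
  have hXY : energyY γ t₁ - energyX γ t₁ = 0 := by
    simpa [hne] using hloc.hasDerivAt_eq_zero ((h.isUnitGeodesic.hasDerivAt_deriv_two t₁).pow 2)
  have hX : energyX γ t₁ = |P * Q| := by
    have hmul := h.energyX_mul_energyY t₁
    rw [sub_eq_zero.1 hXY, ← sq] at hmul
    exact (sq_eq_sq₀ (energyX_nonneg γ t₁) (abs_nonneg _)).1 hmul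
  exact ⟨hXY, by linarith [h.isUnitGeodesic.energy_add_eq_one t₁]⟩

theorem add_mul_eq_of_add_eq (h : HasMomenta γ P Q) {T a b : ℝ}
    (hT : ∀ t, γ (t + T) = γ t + !₂[a, b, 0]) (t : ℝ) :
    P * γ (t + T) 0 + Q * γ (t + T) 1 = P * γ t 0 + Q * γ t 1 + 2 * (P * a) := by
  simp only [hT, PiLp.add_apply, Matrix.cons_val]
  linarith [h.mul_eq_of_add_eq hT]

theorem abs_deriv_two_le_of_add_eq (h : HasMomenta γ P Q) {T a b : ℝ}
    (hT : ∀ t, γ (t + T) = γ t + !₂[a, b, 0]) {t₀ t₁ : ℝ} (ht₁ : t₁ ∈ Set.Icc t₀ (t₀ + T))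
    (hw₀ : deriv γ t₀ 2 = 0) : |deriv γ t₁ 2| ≤ 2 * (P * a) := by
  have hadd₀ := h.monotone_add_deriv_two ht₁.1
  have hadd₁ := h.monotone_add_deriv_two ht₁.2
  have hsub₀ := h.monotone_sub_deriv_two ht₁.1
  have hsub₁ := h.monotone_sub_deriv_two ht₁.2
  simp only [h.add_mul_eq_of_add_eq hT, periodic_deriv_of_add_eq hT t₀, hw₀]
    at hadd₀ hadd₁ hsub₀ hsub₁
  exact abs_le.2 ⟨by linarith, by linarith⟩

theorem le_abs_mul (h : HasMomenta γ P Q) (hA : ¬ IsTypeA γ) {T a b : ℝ} (hT0 : 0 < T)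
    (hT : ∀ t, γ (t + T) = γ t + !₂[a, b, 0]) : 1 / 8 ≤ |a * b| := by
  have hw_per : Function.Periodic (fun t => deriv γ t 2) T := fun t =>
    congrArg (fun p : Sol => p 2) (periodic_deriv_of_add_eq hT t)
  obtain ⟨t₀, t₁, ht₁, hw₀, hmax⟩ := exists_eq_zero_and_sq_le_of_periodic hT0
    (h.isUnitGeodesic.hasDerivAt_coord 2) (fun t => by simp [hT])
    (continuous_iff_continuousAt.2 fun t => (h.isUnitGeodesic.hasDerivAt_deriv_two t).continuousAt)
    hw_per
  have hw₁ : deriv γ t₁ 2 ≠ 0 := fun h0 => hA <| h.isTypeA_of_deriv_two_eq_zero fun t =>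
    sq_nonpos_iff _ |>.1 <| by simpa [h0] using hmax t
  obtain ⟨hXY, hw_sq⟩ := h.deriv_two_sq_eq_of_sq_le hmax hw₁
  have hw_le := h.abs_deriv_two_le_of_add_eq hT ht₁ hw₀
  have hT_le : |P * Q| * T ≤ P * a := by
    linarith [h.monotone_sub_mul (le_add_of_nonneg_right hT0.le : (0 : ℝ) ≤ 0 + T),
      h.add_mul_eq_of_add_eq hT 0]
  have hTsq : 1 ≤ 2 * T ^ 2 :=
    (h.isUnitGeodesic.one_le_two_mul_sq ht₁.1 hw₀ hw₁ hmax hXY).trans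
      (by gcongr; exacts [sub_nonneg.2 ht₁.1, sub_le_iff_le_add'.2 ht₁.2])
  have hab : |P * Q| * |a * b| = (P * a) ^ 2 := by
    rw [← abs_mul, show P * Q * (a * b) = P * a * (Q * b) by ring, ← h.mul_eq_of_add_eq hT,
      abs_mul_self, sq]
  have hPQ_sq : |P * Q| ^ 2 ≤ 2 * (P * a) ^ 2 := by
    calc |P * Q| ^ 2 ≤ |P * Q| ^ 2 * (2 * T ^ 2) := le_mul_of_one_le_right (sq_nonneg _) hTsq
      _ = 2 * (|P * Q| * T) ^ 2 := by ring
      _ ≤ 2 * (P * a) ^ 2 := by gcongr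
  have hPa_sq : 1 - 2 * |P * Q| ≤ 4 * (P * a) ^ 2 := by
    rw [← hw_sq, ← sq_abs]
    calc |deriv γ t₁ 2| ^ 2 ≤ (2 * (P * a)) ^ 2 := by gcongr
      _ = 4 * (P * a) ^ 2 := by ring
  -- If `|P * Q|` is small, `γ` reaches a large vertical speed, which bounds `P * a` from below by
  -- `hw_le`; otherwise `P * a` is bounded from below because the period is.
  rcases le_total |P * Q| (1 / 4) with hle | hle
  · linarith [mul_le_mul_of_nonneg_right hle (abs_nonneg (a * b))]
  · refine le_of_mul_le_mul_left ?_ (by linarith : 0 < |P * Q|)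
    linarith [mul_le_mul_of_nonneg_left hle (abs_nonneg (P * Q))]

end HasMomenta

namespace IsTypeC

theorem exists_hasMomenta (h : IsTypeC γ) : ∃ P Q, HasMomenta γ P Q ∧ P ≠ 0 ∧ Q ≠ 0 := by
  obtain ⟨h, -, hB⟩ := h
  obtain ⟨P, Q, hPQ⟩ := h.exists_hasMomenta
  refine ⟨P, Q, hPQ, ?_, ?_⟩ <;> rintro rfl
  · exact hB ⟨h, Or.inr fun t => eq_of_hasDerivAt_zero
      (fun s => (h.hasDerivAt_coord 0 s).congr_deriv (by rw [hPQ.deriv_zero, zero_mul])) t 0⟩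
  · exact hB ⟨h, Or.inl fun t => eq_of_hasDerivAt_zero
      (fun s => (h.hasDerivAt_coord 1 s).congr_deriv (by rw [hPQ.deriv_one, zero_mul])) t 0⟩

theorem le_abs_mul (h : IsTypeC γ) {φ : Sol → Sol} (hφ : IsStraight φ) {T : ℝ} (hT0 : 0 < T)
    (hT : ∀ t, γ (t + T) = φ (γ t)) : ∃ a b, IsHorizontal φ a b ∧ 1 / 8 ≤ |a * b| := by
  obtain ⟨P, Q, hPQ, hP, hQ⟩ := h.exists_hasMomenta
  obtain ⟨a, b, hab⟩ := hPQ.exists_isHorizontal hP hQ hφ hT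
  exact ⟨a, b, hab, hPQ.le_abs_mul h.2.1 hT0 fun t => (hT t).trans (hab _)⟩

end IsTypeC

end TypeC

/-! ### Symplectic paths which are products of planar ones -/

/-- The functions `p` and `s` of the solution `p t + s t • G` of `Ψ' = G Ψ`, `Ψ 0 = 1`, when
`G ^ 2 = κ`. -/
structure IsOscillator (κ : ℝ) (p s : ℝ → ℝ) : Prop where
  hasDerivAt_left : ∀ t, HasDerivAt p (κ * s t) t
  hasDerivAt_right : ∀ t, HasDerivAt s (p t) t
  left_zero : p 0 = 1
  right_zero : s 0 = 0

theorem isOscillator_zero : IsOscillator 0 (fun _ => 1) id where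
  hasDerivAt_left t := by simpa using hasDerivAt_const t (1 : ℝ)
  hasDerivAt_right := hasDerivAt_id
  left_zero := rfl
  right_zero := rfl

theorem isOscillator_sq {μ : ℝ} (hμ : μ ≠ 0) :
    IsOscillator (μ ^ 2) (fun t => Real.cosh (μ * t)) fun t => Real.sinh (μ * t) / μ where
  hasDerivAt_left t := ((hasDerivAt_const_mul μ).cosh).congr_deriv (by field_simp)
  hasDerivAt_right t := ((hasDerivAt_const_mul μ).sinh.div_const μ).congr_deriv (by field_simp)
  left_zero := by simp
  right_zero := by simp

theorem isOscillator_neg_sq {ν : ℝ} (hν : ν ≠ 0) :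
    IsOscillator (-ν ^ 2) (fun t => Real.cos (ν * t)) fun t => Real.sin (ν * t) / ν where
  hasDerivAt_left t := ((hasDerivAt_const_mul ν).cos).congr_deriv (by field_simp)
  hasDerivAt_right t := ((hasDerivAt_const_mul ν).sin.div_const ν).congr_deriv (by field_simp)
  left_zero := by simp
  right_zero := by simp

theorem IsOscillator.sq_sub_eq_one {κ : ℝ} {p s : ℝ → ℝ} (h : IsOscillator κ p s) (t : ℝ) :
    p t ^ 2 - κ * s t ^ 2 = 1 := by
  have hconst : ∀ t, HasDerivAt (fun t => p t ^ 2 - κ * s t ^ 2) 0 t := fun t =>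
    (((h.hasDerivAt_left t).fun_pow 2).sub (((h.hasDerivAt_right t).fun_pow 2).const_mul κ)
      ).congr_deriv (by
        push_cast
        ring)
  simpa [h.left_zero, h.right_zero] using eq_of_hasDerivAt_zero hconst t 0

section Blocks

variable {ι : Type*} [DecidableEq ι]

/-- The infinitesimal symplectic matrix `p_i' = α_i q_i`, `q_i' = β_i p_i`. -/
def blockGenerator (α β : ι → ℝ) : Matrix (ι ⊕ ι) (ι ⊕ ι) ℝ :=
  Matrix.fromBlocks 0 (Matrix.diagonal α) (Matrix.diagonal β) 0

/-- The path of matrices acting on the `i`-th plane as `p_i + s_i G`, where `G` is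
`blockGenerator α β`. -/
def blockPath (α β : ι → ℝ) (p s : ι → ℝ → ℝ) (t : ℝ) : Matrix (ι ⊕ ι) (ι ⊕ ι) ℝ :=
  Matrix.fromBlocks (Matrix.diagonal fun i => p i t) (Matrix.diagonal fun i => α i * s i t)
    (Matrix.diagonal fun i => β i * s i t) (Matrix.diagonal fun i => p i t)

/-- The path `blockPath α β p s` is the exponential of the multiples of `blockGenerator α β`. -/
def IsBlockSolution (α β : ι → ℝ) (p s : ι → ℝ → ℝ) : Prop :=
  ∀ i, IsOscillator (α i * β i) (p i) (s i)

theorem hasDerivAt_diagonal_apply {d : ℝ → ι → ℝ} {d' : ι → ℝ} {t : ℝ}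
    (hd : ∀ i, HasDerivAt (fun s => d s i) (d' i) t) (i j : ι) :
    HasDerivAt (fun s => Matrix.diagonal (d s) i j) (Matrix.diagonal d' i j) t := by
  simp only [Matrix.diagonal_apply]
  split_ifs
  · exact hd i
  · exact hasDerivAt_const t 0

theorem blockGenerator_add_smul_J (α β : ι → ℝ) (δ : ℝ) :
    blockGenerator α β + δ • Matrix.J ι ℝ =
      blockGenerator (fun i => α i - δ) fun i => β i + δ := by
  rw [Matrix.J, blockGenerator, blockGenerator, Matrix.fromBlocks_smul, Matrix.fromBlocks_add,
    smul_zero, add_zero, smul_neg, ← Matrix.diagonal_one, ← Matrix.diagonal_smul,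
    Matrix.diagonal_neg, Matrix.diagonal_add, Matrix.diagonal_add]
  simp [sub_eq_add_neg]

namespace IsBlockSolution

variable {α β : ι → ℝ} {p s : ι → ℝ → ℝ}

theorem blockPath_zero (h : IsBlockSolution α β p s) : blockPath α β p s 0 = 1 := by
  simp [blockPath, (h _).left_zero, (h _).right_zero]

variable [Fintype ι]

theorem mem_symplecticGroup (h : IsBlockSolution α β p s) (t : ℝ) :
    blockPath α β p s t ∈ Matrix.symplecticGroup ι ℝ := by
  rw [SymplecticGroup.mem_iff, blockPath, Matrix.J, Matrix.fromBlocks_transpose,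
    Matrix.fromBlocks_multiply, Matrix.fromBlocks_multiply]
  simp only [Matrix.diagonal_transpose, Matrix.diagonal_mul_diagonal, Matrix.diagonal_neg,
    Matrix.diagonal_add, ← Matrix.diagonal_one, ← Matrix.diagonal_zero]
  congr 2 <;> ext i <;> simp <;> linarith [(h i).sq_sub_eq_one t]

theorem hasDerivAt_blockPath (h : IsBlockSolution α β p s) (t : ℝ) (i j : ι ⊕ ι) :
    HasDerivAt (fun t => blockPath α β p s t i j)
      ((blockGenerator α β * blockPath α β p s t) i j) t := by
  have hmul : blockGenerator α β * blockPath α β p s t =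
      Matrix.fromBlocks (Matrix.diagonal fun i => α i * β i * s i t)
        (Matrix.diagonal fun i => α i * p i t) (Matrix.diagonal fun i => β i * p i t)
        (Matrix.diagonal fun i => α i * β i * s i t) := by
    rw [blockGenerator, blockPath, Matrix.fromBlocks_multiply]
    simp [Matrix.diagonal_mul_diagonal, mul_assoc, mul_left_comm]
  rw [hmul]
  rcases i with i | i <;> rcases j with j | j
  · exact hasDerivAt_diagonal_apply (fun i => (h i).hasDerivAt_left t) i j
  · exact hasDerivAt_diagonal_apply (fun i => ((h i).hasDerivAt_right t).const_mul (α i)) i j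
  · exact hasDerivAt_diagonal_apply (fun i => ((h i).hasDerivAt_right t).const_mul (β i)) i j
  · exact hasDerivAt_diagonal_apply (fun i => (h i).hasDerivAt_left t) i j

theorem matDeriv_eq (h : IsBlockSolution α β p s) (t : ℝ) :
    matDeriv (blockPath α β p s) t = blockGenerator α β * blockPath α β p s t :=
  Matrix.ext fun i j => (h.hasDerivAt_blockPath t i j).deriv

theorem isSymplecticPath (h : IsBlockSolution α β p s) : IsSymplecticPath (blockPath α β p s) := by
  refine ⟨fun i j => contDiff_one_iff_deriv.2
    ⟨fun t => (h.hasDerivAt_blockPath t i j).differentiableAt, ?_⟩, h.mem_symplecticGroup,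
    h.blockPath_zero⟩
  rw [funext fun t => (h.hasDerivAt_blockPath t i j).deriv]
  simp only [Matrix.mul_apply]
  exact continuous_finsetSum _ fun k _ => continuous_const.mul <|
    continuous_iff_continuousAt.2 fun t => (h.hasDerivAt_blockPath t k j).continuousAt

theorem crossingSpace_eq_bot (h : IsBlockSolution α β p s) {t : ℝ} (ht : ∀ i, p i t ≠ 1) :
    crossingSpace (blockPath α β p s) t = ⊥ := by
  rw [crossingSpace, LinearMap.ker_eq_bot']
  intro v hv
  rw [Matrix.toLin'_apply, Matrix.sub_mulVec, Matrix.one_mulVec, sub_eq_zero, blockPath,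
    Matrix.fromBlocks_mulVec] at hv
  have hl : ∀ i, p i t * v (.inl i) + α i * s i t * v (.inr i) = v (.inl i) := fun i => by
    simpa [Matrix.mulVec_diagonal] using congrFun hv (.inl i)
  have hr : ∀ i, β i * s i t * v (.inl i) + p i t * v (.inr i) = v (.inr i) := fun i => by
    simpa [Matrix.mulVec_diagonal] using congrFun hv (.inr i)
  -- The planar component of the path has trace `2 * p i t` and determinant one.
  have hdet : ∀ i, 2 - 2 * p i t ≠ 0 := fun i hi => ht i (by linarith)
  ext (i | i)
  · refine (mul_eq_zero.1 ?_).resolve_left (hdet i)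
    linear_combination (p i t - 1) * hl i - α i * s i t * hr i -
      v (.inl i) * (h i).sq_sub_eq_one t
  · refine (mul_eq_zero.1 ?_).resolve_left (hdet i)
    linear_combination (p i t - 1) * hr i - β i * s i t * hl i -
      v (.inr i) * (h i).sq_sub_eq_one t

theorem crossingSpace_zero (h : IsBlockSolution α β p s) :
    crossingSpace (blockPath α β p s) 0 = ⊤ := by
  rw [crossingSpace, h.blockPath_zero, sub_self, map_zero, LinearMap.ker_zero]

theorem crossingForm_zero (h : IsBlockSolution α β p s)
    (v : crossingSpace (blockPath α β p s) 0) :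
    crossingForm (blockPath α β p s) 0 v =
      QuadraticMap.weightedSumSquares ℝ (Sum.elim β (-α)) (v : ι ⊕ ι → ℝ) := by
  have hdiag : (Matrix.J ι ℝ).transpose * matDeriv (blockPath α β p s) 0 =
      Matrix.diagonal (Sum.elim β (-α)) := by
    rw [h.matDeriv_eq, h.blockPath_zero, Matrix.mul_one, blockGenerator, Matrix.J,
      Matrix.fromBlocks_transpose, Matrix.fromBlocks_multiply]
    simp [← Matrix.fromBlocks_diagonal]
  rw [crossingForm, hdiag, QuadraticMap.restrict_apply, QuadraticMap.weightedSumSquares_apply]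
  change Matrix.toLinearMap₂' ℝ (Matrix.diagonal (Sum.elim β (-α))) _ _ = _
  simp only [Matrix.toLinearMap₂'_apply, Matrix.diagonal_apply]
  simp [mul_left_comm, mul_comm]

theorem crossingForm_equivalent (h : IsBlockSolution α β p s) :
    (crossingForm (blockPath α β p s) 0).Equivalent
      (QuadraticMap.weightedSumSquares ℝ (Sum.elim β (-α))) :=
  ⟨{ LinearEquiv.ofTop _ h.crossingSpace_zero with
      map_app' := fun v => (h.crossingForm_zero v).symm }⟩

theorem isRegularCrossing_zero (h : IsBlockSolution α β p s) (hα : ∀ i, α i ≠ 0)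
    (hβ : ∀ i, β i ≠ 0) : IsRegularCrossing (blockPath α β p s) 0 := by
  have hne : ∀ i, Sum.elim β (-α) i ≠ 0 := Sum.rec hβ fun i => neg_ne_zero.2 (hα i)
  intro v hv
  ext i
  have hpolar := hv ⟨Pi.single i 1, h.crossingSpace_zero ▸ Submodule.mem_top⟩
  simp only [QuadraticMap.polar, h.crossingForm_zero, QuadraticMap.weightedSumSquares_apply,
    Submodule.coe_add, Pi.add_apply, ← Finset.sum_sub_distrib] at hpolar
  rw [Finset.sum_eq_single i (fun j _ hj => by simp [hj]) (by simp), Pi.single_eq_same] at hpolar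
  refine (mul_eq_zero.1 (?_ : Sum.elim β (-α) i * (v : ι ⊕ ι → ℝ) i = 0)).resolve_left (hne i)
  simp only [smul_eq_mul] at hpolar
  linarith

theorem crossingSignature_zero (h : IsBlockSolution α β p s) :
    crossingSignature (blockPath α β p s) 0 =
      ({i | 0 < Sum.elim β (-α) i}.ncard : ℤ) - {i | Sum.elim β (-α) i < 0}.ncard := by
  rw [crossingSignature, QuadraticForm.sigPos_of_equiv_weightedSumSquares h.crossingForm_equivalent,
    QuadraticForm.sigNeg_of_equiv_weightedSumSquares h.crossingForm_equivalent]

theorem hasRegularIndex (h : IsBlockSolution α β p s) (hα : ∀ i, α i ≠ 0) (hβ : ∀ i, β i ≠ 0)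
    {T : ℝ} (hT : 0 < T) (hp : ∀ t ∈ Set.Ioc 0 T, ∀ i, p i t ≠ 1) {k : ℤ}
    (hk : 2 * k = crossingSignature (blockPath α β p s) 0) :
    HasRegularIndex (blockPath α β p s) T k := by
  refine ⟨h.isSymplecticPath, h.crossingSpace_eq_bot (hp T ⟨hT, le_rfl⟩), fun t ht => ?_, ∅,
    fun t => ?_, by simp [hk]⟩
  · rcases ht.1.eq_or_lt with rfl | h0t
    · exact h.isRegularCrossing_zero hα hβ
    · intro v _
      exact Subtype.ext ((Submodule.eq_bot_iff _).1
        (h.crossingSpace_eq_bot (hp t ⟨h0t, ht.2⟩)) v v.2)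
  · simp only [Finset.notMem_empty, false_iff, not_and, not_not]
    exact fun ht => h.crossingSpace_eq_bot (hp t ⟨ht.1, ht.2.le⟩)

end IsBlockSolution

theorem HasRegularIndex.hasConleyZehnderIndex [Fintype ι] {Ψ : ℝ → Matrix (ι ⊕ ι) (ι ⊕ ι) ℝ}
    {T : ℝ} {k : ℤ} (h : HasRegularIndex Ψ T k) : HasConleyZehnderIndex Ψ T k :=
  ⟨h.1, fun _ => Ψ, Continuous.continuousOn (continuous_matrix fun i j =>
      (h.1.1 i j).continuous.comp continuous_snd),
    fun _ _ t _ => h.1.2.1 t, fun _ _ => ⟨h.1.2.2, h.2.1⟩, fun _ _ => rfl, h⟩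

theorem IsBlockSolution.hasBottIndex [Fintype ι] {α β : ι → ℝ} {p s : ι → ℝ → ℝ}
    (h : IsBlockSolution α β p s) {T δ₀ : ℝ} {k : ℤ} (hδ₀ : 0 < δ₀)
    (hδ : ∀ δ ∈ Set.Ioo 0 δ₀, ∃ p' s' : ι → ℝ → ℝ,
      IsBlockSolution (fun i => α i - δ) (fun i => β i + δ) p' s' ∧
        HasRegularIndex (blockPath (fun i => α i - δ) (fun i => β i + δ) p' s') T k) :
    HasBottIndex (blockPath α β p s) T k := by
  refine ⟨h.isSymplecticPath, δ₀, hδ₀, fun δ hδδ₀ => ?_⟩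
  obtain ⟨p', s', h', hk⟩ := hδ δ hδδ₀
  refine ⟨_, h'.blockPath_zero, fun t => ?_, hk.hasConleyZehnderIndex⟩
  rw [h'.matDeriv_eq, h.matDeriv_eq, Matrix.mul_nonsing_inv_cancel_right _ _
    (SymplecticGroup.symplectic_det (h.mem_symplecticGroup t)), blockGenerator_add_smul_J]

end Blocks

/-! ### The index of geodesics of type A -/

/-- The matrix of the linearized geodesic flow along a geodesic of type `A`. -/
def typeAFlow : ℝ → Matrix (Fin 2 ⊕ Fin 2) (Fin 2 ⊕ Fin 2) ℝ :=
  blockPath ![1, -1] ![0, 2] ![fun _ => 1, fun t => Real.cos (√2 * t)]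
    ![id, fun t => Real.sin (√2 * t) / √2]

theorem isBlockSolution_typeA : IsBlockSolution ![1, -1] ![0, 2]
    ![fun _ => 1, fun t => Real.cos (√2 * t)] ![id, fun t => Real.sin (√2 * t) / √2] := by
  intro i
  fin_cases i
  · simpa using isOscillator_zero
  · simpa using isOscillator_neg_sq (ν := √2) (by positivity)

/-- For the perturbation by `δ`, the first plane is hyperbolic and the second one turns slowly. -/
theorem exists_isBlockSolution_typeA_perturbed {δ : ℝ} (hδ : δ ∈ Set.Ioo 0 (1 / 2)) :
    ∃ p s, IsBlockSolution (fun i => ![1, -1] i - δ) (fun i => ![0, 2] i + δ) p s ∧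
      ∀ t ∈ Set.Ioc 0 1, ∀ i : Fin 2, p i t ≠ 1 := by
  obtain ⟨hδ0, hδ2⟩ := hδ
  obtain ⟨μ, hμ, hμ_sq⟩ : ∃ μ > 0, μ ^ 2 = (1 - δ) * δ :=
    have hpos : 0 < (1 - δ) * δ := mul_pos (by linarith) hδ0
    ⟨√((1 - δ) * δ), Real.sqrt_pos.2 hpos, Real.sq_sqrt hpos.le⟩
  obtain ⟨ν, hν, hν_sq⟩ : ∃ ν > 0, ν ^ 2 = (1 + δ) * (2 + δ) :=
    have hpos : 0 < (1 + δ) * (2 + δ) := by positivity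
    ⟨√((1 + δ) * (2 + δ)), Real.sqrt_pos.2 hpos, Real.sq_sqrt hpos.le⟩
  refine ⟨![fun t => Real.cosh (μ * t), fun t => Real.cos (ν * t)],
    ![fun t => Real.sinh (μ * t) / μ, fun t => Real.sin (ν * t) / ν],
    Fin.forall_fin_two.2 ⟨?_, ?_⟩, fun t ht => Fin.forall_fin_two.2 ⟨?_, ?_⟩⟩
  · simpa [hμ_sq] using isOscillator_sq hμ.ne'
  · have hκ : (-1 - δ) * (2 + δ) = -ν ^ 2 := by linear_combination hν_sq
    simpa [hκ] using isOscillator_neg_sq hν.ne'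
  · exact (Real.one_lt_cosh.2 (mul_pos hμ ht.1).ne').ne'
  · have hpos : 0 < ν * t := mul_pos hν ht.1
    have hlt : ν * t < 2 * Real.pi := by
      have hν2 : ν < 2 := by nlinarith
      nlinarith [Real.pi_gt_three, ht.1, ht.2]
    exact fun hcos => hpos.ne' ((Real.cos_eq_one_iff_of_lt_of_lt (by linarith) hlt).1 hcos)

theorem hasBottIndex_typeAFlow {T : ℝ} (hT : 0 < T) (hT1 : T ≤ 1) :
    HasBottIndex typeAFlow T 1 := by
  refine isBlockSolution_typeA.hasBottIndex (half_pos one_pos) fun δ hδ => ?_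
  obtain ⟨p, s, h, hp⟩ := exists_isBlockSolution_typeA_perturbed hδ
  obtain ⟨hδ0, hδ2⟩ := hδ
  refine ⟨p, s, h, h.hasRegularIndex ?_ ?_ hT (fun t ht => hp t ⟨ht.1, ht.2.trans hT1⟩) ?_⟩
  · exact Fin.forall_fin_two.2 ⟨by simp; linarith, by simp; linarith⟩
  · exact Fin.forall_fin_two.2 ⟨by simp; linarith, by simp; linarith⟩
  · have hpos : {i | 0 < Sum.elim (fun i => ![0, 2] i + δ) (-fun i => ![1, -1] i - δ) i} =
        {.inl 0, .inl 1, .inr 1} := by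
      ext (i | i) <;> fin_cases i <;> simp <;> linarith
    have hneg : {i | Sum.elim (fun i => ![0, 2] i + δ) (-fun i => ![1, -1] i - δ) i < 0} =
        {.inr 0} := by
      ext (i | i) <;> fin_cases i <;> simp <;> linarith
    rw [h.crossingSignature_zero, hpos, hneg, Set.ncard_singleton, Set.ncard_eq_toFinset_card']
    simp

theorem differentiable_geodesicField : Differentiable ℝ geodesicField := by
  rw [funext geodesicField_eq]
  refine differentiable_snd.prodMk (differentiable_euclidean.2 fun i => ?_)
  fin_cases i <;> simp only [Fin.zero_eta, Fin.mk_one, Fin.reduceFinMk, Matrix.cons_val] <;>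
    fun_prop

theorem fderiv_geodesicField (w u : Sol × Sol) (hz : w.2 2 = 0) :
    fderiv ℝ geodesicField w u = (u.2, !₂[2 * u.2 2 * w.2 0, -(2 * u.2 2 * w.2 1),
      2 * u.1 2 * (Real.exp (2 * w.1 2) * w.2 1 ^ 2 + Real.exp (-(2 * w.1 2)) * w.2 0 ^ 2) +
      2 * Real.exp (2 * w.1 2) * w.2 1 * u.2 1 -
      2 * Real.exp (-(2 * w.1 2)) * w.2 0 * u.2 0]) := by
  have hline : HasDerivAt (fun s : ℝ => w + s • u) u 0 := by
    simpa using ((hasDerivAt_id (0 : ℝ)).smul_const u).const_add w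
  have hfield : HasFDerivAt geodesicField (fderiv ℝ geodesicField w) (w + (0 : ℝ) • u) := by
    simpa using (differentiable_geodesicField w).hasFDerivAt
  have hfst := (ContinuousLinearMap.fst ℝ Sol Sol).hasFDerivAt.comp_hasDerivAt (0 : ℝ) hline
  have hsnd := (ContinuousLinearMap.snd ℝ Sol Sol).hasFDerivAt.comp_hasDerivAt (0 : ℝ) hline
  have hpos := hasDerivAt_iff_coord.1 hfst 2
  have hvel := hasDerivAt_iff_coord.1 hsnd
  refine (hfield.comp_hasDerivAt (0 : ℝ) hline).unique ?_
  simp only [Function.comp_def, geodesicField_eq]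
  refine HasDerivAt.prodMk hsnd (hasDerivAt_iff_coord.2 fun i => ?_)
  fin_cases i
  · refine (((hvel 2).const_mul 2).fun_mul (hvel 0)).congr_deriv ?_
    simp [hz]
  · refine (((hvel 2).const_mul 2).fun_mul (hvel 1)).fun_neg.congr_deriv ?_
    simp [hz]
  · refine (((hpos.const_mul 2).exp.fun_mul ((hvel 1).fun_pow 2)).fun_sub
      ((hpos.const_mul 2).fun_neg.exp.fun_mul ((hvel 0).fun_pow 2))).congr_deriv ?_
    simp
    ring

namespace IsTypeA

variable {γ : ℝ → Sol}

theorem deriv_eq (h : IsTypeA γ) (t : ℝ) : deriv γ t = deriv γ 0 := by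
  have hz : γ t 2 = γ 0 2 := eq_of_hasDerivAt_zero
    (fun s => (h.1.hasDerivAt_coord 2 s).congr_deriv (h.deriv_two s)) t 0
  obtain ⟨-, a, b, -, -, hderiv⟩ := h
  rw [hderiv, hderiv]
  simp only [fieldX, fieldY, hz]

theorem isLinearizedFlow (h : IsTypeA γ) : IsLinearizedFlow γ typeAFlow := by
  have hframe : ∀ t, contactFrame (tangentLift γ t) = contactFrame (tangentLift γ 0) := fun t => by
    simp only [contactFrame, tangentLift, fieldZ, h.deriv_eq t]
  refine ⟨isBlockSolution_typeA.blockPath_zero, fun j t => ?_⟩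
  simp only [hframe]
  refine (HasDerivAt.fun_sum fun i _ =>
    (isBlockSolution_typeA.hasDerivAt_blockPath t i j).smul_const _).congr_deriv ?_
  have hunit := h.1.energy_add_eq_one t
  rw [energyX, energyY, h.deriv_two, h.deriv_eq] at hunit
  rw [fderiv_geodesicField _ _ (h.deriv_two t), ← typeAFlow]
  generalize typeAFlow t = Ψ
  simp only [tangentLift, h.deriv_eq t, Matrix.mul_apply, Fintype.sum_sum_type, Fin.sum_univ_two,
    contactFrame, fieldZ, blockGenerator]
  refine Prod.ext ?_ ?_ <;> ext i <;> fin_cases i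
  · simp
    ring
  · simp
    ring
  · simp
  · simp
    ring
  · simp
    ring
  · simp
    linear_combination 2 * Ψ (.inl 1) j * hunit

theorem hasMorseBottIndex (h : IsTypeA γ) {T : ℝ} (hT : 0 < T) (hT1 : T ≤ 1) :
    HasMorseBottIndex γ T 1 :=
  ⟨typeAFlow, h.isLinearizedFlow, hasBottIndex_typeAFlow hT hT1⟩

end IsTypeA

/-! ### The metric of a quotient of Sol -/

theorem solMetric_symm (q v w : Sol) : solMetric q v w = solMetric q w v := by
  rw [solMetric_eq, solMetric_eq]
  ring

theorem exp_mul_norm_sq_le_solMetric (q v : Sol) :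
    Real.exp (-(2 * |q 2|)) * ‖v‖ ^ 2 ≤ solMetric q v v := by
  have hX : Real.exp (-(2 * |q 2|)) ≤ Real.exp (-(2 * q 2)) := by
    gcongr
    exact le_abs_self _
  have hY : Real.exp (-(2 * |q 2|)) ≤ Real.exp (2 * q 2) := by
    gcongr
    linarith [neg_abs_le (q 2)]
  have hZ : Real.exp (-(2 * |q 2|)) ≤ 1 := Real.exp_le_one_iff.2 (by simp)
  rw [solMetric_eq, EuclideanSpace.real_norm_sq_eq, Fin.sum_univ_three]
  nlinarith [mul_le_mul_of_nonneg_right hX (sq_nonneg (v 0)),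
    mul_le_mul_of_nonneg_right hY (sq_nonneg (v 1)),
    mul_le_mul_of_nonneg_right hZ (sq_nonneg (v 2))]

theorem solMetric_pos (q : Sol) {v : Sol} (hv : v ≠ 0) : 0 < solMetric q v v :=
  lt_of_lt_of_le (by positivity) (exp_mul_norm_sq_le_solMetric q v)

theorem isVonNBounded_solMetric (q : Sol) :
    Bornology.IsVonNBounded ℝ {v : Sol | solMetric q v v < 1} := by
  rw [NormedSpace.isVonNBounded_iff, isBounded_iff_forall_norm_le]
  refine ⟨Real.exp |q 2|, fun v hv => ?_⟩
  have hlt : Real.exp (-(2 * |q 2|)) * ‖v‖ ^ 2 < 1 :=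
    (exp_mul_norm_sq_le_solMetric q v).trans_lt hv
  rw [Real.exp_neg, inv_mul_lt_iff₀ (Real.exp_pos _), mul_one] at hlt
  refine (pow_le_pow_iff_left₀ (norm_nonneg v) (Real.exp_pos _).le two_ne_zero).1 (hlt.le.trans ?_)
  rw [← Real.exp_nat_mul, Nat.cast_ofNat]

/-- The pullback of the Sol metric at `q` by a linear map `A`, as a continuous bilinear form. -/
def pullbackForm (q : Sol) (A : Sol →L[ℝ] Sol) : Sol →L[ℝ] Sol →L[ℝ] ℝ :=
  ∑ i, (solGram q i i • ((EuclideanSpace.proj i : Sol →L[ℝ] ℝ) ∘L A)).smulRight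
    ((EuclideanSpace.proj i : Sol →L[ℝ] ℝ) ∘L A)

theorem pullbackForm_apply (q : Sol) (A : Sol →L[ℝ] Sol) (v w : Sol) :
    pullbackForm q A v w = solMetric q (A v) (A w) := by
  rw [solMetric_eq]
  simp [pullbackForm, Fin.sum_univ_three, solGram]

theorem contDiff_pullbackForm :
    ContDiff ℝ ∞ fun a : Sol × (Sol →L[ℝ] Sol) => pullbackForm a.1 a.2 := by
  have hcoord : ∀ i, ContDiff ℝ ∞ fun a : Sol × (Sol →L[ℝ] Sol) =>
      (EuclideanSpace.proj i : Sol →L[ℝ] ℝ) ∘L a.2 := fun i =>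
    contDiff_const.clm_comp contDiff_snd
  have hgram : ∀ i, ContDiff ℝ ∞ fun a : Sol × (Sol →L[ℝ] Sol) => solGram a.1 i i := by
    simp only [solGram, Matrix.diagonal_apply_eq]
    intro i
    fin_cases i <;> simp only [Fin.zero_eta, Fin.mk_one, Fin.reduceFinMk, Matrix.cons_val] <;>
      fun_prop
  exact ContDiff.sum fun i _ => ((hgram i).smul (hcoord i)).smulRight (hcoord i)

section

variable {L : Type*} [TopologicalSpace L] [ChartedSpace (EuclideanSpace ℝ (Fin 3)) L]
  {Λ : Subgroup (Equiv.Perm Sol)} {π : Sol → L} {σ τ : L → Sol} {x : L}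

/-- The differential at `x` of a map to Sol, all the tangent spaces being modelled on `ℝ³`. -/
def dSol (σ : L → Sol) (x : L) : Sol →L[ℝ] Sol := mfderiv (𝓡 3) (𝓡 3) σ x

/-- The differential at `p` of a map from Sol, all the tangent spaces being modelled on `ℝ³`. -/
def dProj (π : Sol → L) (p : Sol) : Sol →L[ℝ] Sol := mfderiv (𝓡 3) (𝓡 3) π p

/-- `σ` is a section of `π` near `x`, differentiable at `x`. -/
def IsLocalSection (π : Sol → L) (σ : L → Sol) (x : L) : Prop :=
  MDifferentiableAt (𝓡 3) (𝓡 3) σ x ∧ ∀ᶠ y in nhds x, π (σ y) = y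

theorem IsLocalSection.dProj_dSol (hσ : IsLocalSection π σ x) (h : IsSolQuotient Λ π) (v : Sol) :
    dProj π (σ x) (dSol σ x v) = v := by
  have hcomp : mfderiv (𝓡 3) (𝓡 3) (π ∘ σ) x = (dProj π (σ x)).comp (dSol σ x) :=
    mfderiv_comp x (h.localDiffeo.mdifferentiable (by simp) (σ x)) hσ.1
  have hid : mfderiv (𝓡 3) (𝓡 3) (π ∘ σ) x = ContinuousLinearMap.id ℝ Sol :=
    (Filter.EventuallyEq.mfderiv_eq hσ.2).trans mfderiv_id
  exact congrArg (fun A : Sol →L[ℝ] Sol => A v) (hcomp.symm.trans hid)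

namespace IsSolQuotient

theorem dProj_injective (h : IsSolQuotient Λ π) (p : Sol) : Function.Injective (dProj π p) :=
  (h.localDiffeo.mfderivToContinuousLinearEquiv (by simp) p).injective

theorem dSol_dProj {p : Sol} (h : IsSolQuotient Λ π) (hσ : IsLocalSection π σ (π p))
    (hp : σ (π p) = p) (v : Sol) : dSol σ (π p) (dProj π p v) = v := by
  refine h.dProj_injective p ?_
  simpa only [hp] using hσ.dProj_dSol h (dProj π p v)

theorem solMetric_dSol_eq (h : IsSolQuotient Λ π) (hσ : IsLocalSection π σ x)
    (hτ : IsLocalSection π τ x) (v w : Sol) :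
    solMetric (σ x) (dSol σ x v) (dSol σ x w) = solMetric (τ x) (dSol τ x v) (dSol τ x w) := by
  obtain ⟨l, hl, hlx⟩ := (h.fibers (σ x) (τ x)).1 (hσ.2.self_of_nhds.trans hτ.2.self_of_nhds.symm)
  obtain ⟨hl_smooth, -, hl_metric⟩ := h.isometry l hl
  have hl_diff : MDifferentiableAt (𝓡 3) (𝓡 3) l (σ x) :=
    (hl_smooth.differentiable (by simp) (σ x)).mdifferentiableAt
  have hlσ : IsLocalSection π (l ∘ σ) x :=
    ⟨hl_diff.comp x hσ.1, hσ.2.mono fun y hy => ((h.fibers _ _).2 ⟨l, hl, rfl⟩).symm.trans hy⟩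
  have hd_comp : dSol (l ∘ σ) x = (fderiv ℝ l (σ x)).comp (dSol σ x) :=
    (mfderiv_comp (I' := 𝓡 3) x hl_diff hσ.1).trans (by rw [mfderiv_eq_fderiv]; rfl)
  have hdτ : ∀ u, dSol τ x u = fderiv ℝ l (σ x) (dSol σ x u) := fun u => by
    refine h.dProj_injective (τ x) ?_
    have hlσ_u := hlσ.dProj_dSol h u
    rw [hd_comp] at hlσ_u
    rw [hτ.dProj_dSol h, ← hlx]
    exact hlσ_u.symm
  rw [hdτ, hdτ, ← hlx, hl_metric]

theorem exists_localSection (h : IsSolQuotient Λ π) (p : Sol) :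
    ∃ σ : L → Sol, σ (π p) = p ∧ ContMDiffAt (𝓡 3) (𝓡 3) ∞ σ (π p) ∧
      ∀ᶠ x in nhds (π p), IsLocalSection π σ x := by
  have hp := h.localDiffeo p
  refine ⟨hp.localInverse, hp.localInverse_left_inv hp.localInverse_mem_target,
    hp.localInverse_contMDiffAt, ?_⟩
  filter_upwards [hp.localInverse_open_source.mem_nhds hp.localInverse_mem_source] with x hx
  have hx_nhds := hp.localInverse_open_source.mem_nhds hx
  exact ⟨(hp.localInverse_contMDiffOn.contMDiffAt hx_nhds).mdifferentiableAt (by simp),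
    Filter.mem_of_superset hx_nhds fun _ => hp.localInverse_right_inv⟩

theorem exists_isLocalSection (h : IsSolQuotient Λ π) (x : L) :
    ∃ σ : L → Sol, IsLocalSection π σ x := by
  obtain ⟨p, rfl⟩ := h.surjective x
  obtain ⟨σ, -, -, hσ⟩ := h.exists_localSection p
  exact ⟨σ, hσ.self_of_nhds⟩

/-- The metric induced by Sol on the tangent space at `x`, read in an arbitrary local section. -/
def quotientForm (h : IsSolQuotient Λ π) (x : L) :
    TangentSpace (𝓡 3) x →L[ℝ] TangentSpace (𝓡 3) x →L[ℝ] ℝ :=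
  pullbackForm ((h.exists_isLocalSection x).choose x) (dSol (h.exists_isLocalSection x).choose x)

theorem quotientForm_apply (h : IsSolQuotient Λ π) (hτ : IsLocalSection π τ x)
    (v w : TangentSpace (𝓡 3) x) :
    h.quotientForm x v w = solMetric (τ x) (dSol τ x v) (dSol τ x w) :=
  (pullbackForm_apply _ _ v w).trans
    (h.solMetric_dSol_eq (h.exists_isLocalSection x).choose_spec hτ v w)

theorem quotientForm_dProj (h : IsSolQuotient Λ π) (p v w : Sol) :
    h.quotientForm (π p) (dProj π p v) (dProj π p w) = solMetric p v w := by
  obtain ⟨σ, hσp, -, hσ⟩ := h.exists_localSection p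
  have hσ := hσ.self_of_nhds
  refine (h.quotientForm_apply hσ (dProj π p v) (dProj π p w)).trans ?_
  rw [h.dSol_dProj hσ hσp, h.dSol_dProj hσ hσp, hσp]

end IsSolQuotient

variable [IsManifold (𝓡 3) ∞ L]

theorem inTangentCoordinates_mfderiv_eq {x₀ : L}
    (hx : x ∈ (trivializationAt Sol (TangentSpace (𝓡 3)) x₀).baseSet) (u : Sol) :
    inTangentCoordinates (𝓡 3) (𝓡 3) id σ (fun x => mfderiv (𝓡 3) (𝓡 3) σ x) x₀ x u =
      dSol σ x ((trivializationAt Sol (TangentSpace (𝓡 3)) x₀).symm x u) := by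
  simp only [inTangentCoordinates, ContinuousLinearMap.inCoordinates, id,
    TangentBundle.continuousLinearMapAt_model_space]
  exact congrArg (dSol σ x) (Bundle.Trivialization.symmL_apply _ hx u)

namespace IsSolQuotient

theorem contMDiff_quotientForm (h : IsSolQuotient Λ π) :
    ContMDiff (𝓡 3) ((𝓡 3).prod 𝓘(ℝ, Sol →L[ℝ] Sol →L[ℝ] ℝ)) ∞
      (fun x : L => Bundle.TotalSpace.mk' (Sol →L[ℝ] Sol →L[ℝ] ℝ)
        (E := fun x : L => TangentSpace (𝓡 3) x →L[ℝ] TangentSpace (𝓡 3) x →L[ℝ] ℝ) x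
        (h.quotientForm x)) := by
  intro x₀
  obtain ⟨p, rfl⟩ := h.surjective x₀
  obtain ⟨σ, -, hσ_smooth, hσ⟩ := h.exists_localSection p
  have hform := contDiff_pullbackForm.contMDiff.contMDiffAt.comp (π p)
    (hσ_smooth.prodMk_space (hσ_smooth.mfderiv_const (m := ∞) (by simp)))
  rw [contMDiffAt_hom_bundle]
  refine ⟨contMDiffAt_id, hform.congr_of_eventuallyEq ?_⟩
  have hbase := (trivializationAt Sol (TangentSpace (𝓡 3)) (π p)).open_baseSet.mem_nhds
    (FiberBundle.mem_baseSet_trivializationAt' (π p))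
  filter_upwards [hσ, hbase] with x hx hx_base
  ext v w
  refine (inCoordinates_apply_eq₂ (F₃ := ℝ) (E₃ := Bundle.Trivial L ℝ) (ϕ := h.quotientForm x)
    hx_base hx_base (by trivial)).trans ?_
  rw [h.quotientForm_apply hx]
  simp only [Function.comp, pullbackForm_apply, inTangentCoordinates_mfderiv_eq hx_base]
  exact congrArg (fun A : ℝ →L[ℝ] ℝ => A _) (Bundle.Trivial.continuousLinearMapAt_trivialization ..)

/-- The metric of a quotient of Sol for which the projection is a local isometry. -/
def quotientMetric (h : IsSolQuotient Λ π) : SmoothMetric L where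
  inner := h.quotientForm
  symm x v w := by
    obtain ⟨σ, hσ⟩ := h.exists_isLocalSection x
    rw [h.quotientForm_apply hσ, h.quotientForm_apply hσ, solMetric_symm]
  pos x v hv := by
    obtain ⟨σ, hσ⟩ := h.exists_isLocalSection x
    rw [h.quotientForm_apply hσ]
    refine solMetric_pos _ fun hσv => hv ?_
    rw [← hσ.dProj_dSol h v, hσv, map_zero]
    rfl
  isVonNBounded x := by
    obtain ⟨σ, hσ⟩ := h.exists_isLocalSection x
    refine ((isVonNBounded_solMetric (σ x)).image (dProj π (σ x))).subset fun v hv => ?_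
    exact ⟨dSol σ x v, (h.quotientForm_apply hσ v v).symm.trans_lt hv, hσ.dProj_dSol h v⟩
  contMDiff := h.contMDiff_quotientForm

theorem isSolMetric_quotientMetric (h : IsSolQuotient Λ π) : IsSolMetric h.quotientMetric Λ π :=
  ⟨h, h.quotientForm_dProj⟩

end IsSolQuotient

end

/-! ### Dilating a quotient of Sol -/

theorem properlyDiscontinuousSMul_map_conj {X : Type*} [TopologicalSpace X]
    {Λ : Subgroup (Equiv.Perm X)} (hΛ : ProperlyDiscontinuousSMul Λ X) {e : Equiv.Perm X}
    (he : Continuous ⇑e⁻¹) :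
    ProperlyDiscontinuousSMul (Λ.map (MulAut.conj e).toMonoidHom) X where
  finite_disjoint_inter_image hK hK' := by
    refine ((hΛ.finite_disjoint_inter_image (hK.image he) (hK'.image he)).image fun k =>
      ⟨e * k * e⁻¹, k, k.2, rfl⟩).subset ?_
    rintro ⟨_, k, hk, rfl⟩ ⟨_, ⟨p, hp, rfl⟩, hp'⟩
    exact ⟨⟨k, hk⟩, ⟨k (e⁻¹ p), ⟨e⁻¹ p, ⟨p, hp, rfl⟩, rfl⟩, ⟨e (k (e⁻¹ p)), hp', by simp⟩⟩, rfl⟩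

theorem IsHorizontal.dilation_conj {τ : Equiv.Perm Sol} {a b : ℝ} (h : IsHorizontal τ a b) (r : ℝ)
    (hr : r ≠ 0) :
    IsHorizontal (dilation r hr * τ * (dilation r hr)⁻¹ : Equiv.Perm Sol) (r * a) (r * b) := by
  intro p
  ext i
  fin_cases i <;> simp [dilation_inv, dilation_apply, h _, mul_add, hr]

namespace IsSolQuotient

variable {L : Type*} [TopologicalSpace L] [ChartedSpace (EuclideanSpace ℝ (Fin 3)) L]
  {Λ : Subgroup (Equiv.Perm Sol)} {π : Sol → L}

theorem conj (h : IsSolQuotient Λ π) {e : Equiv.Perm Sol} (he : ContDiff ℝ ∞ e)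
    (he' : ContDiff ℝ ∞ ⇑e⁻¹) (hiso : ∀ l ∈ Λ, IsSolIsometry (e * l * e⁻¹)) :
    IsSolQuotient (Λ.map (MulAut.conj e).toMonoidHom) (π ∘ ⇑e⁻¹) where
  isometry := by
    rintro _ ⟨l, hl, rfl⟩
    exact hiso l hl
  discrete := properlyDiscontinuousSMul_map_conj h.discrete he'.continuous
  free := by
    rintro _ ⟨l, hl, rfl⟩ p hp
    rw [h.free l hl (e⁻¹ p) (Equiv.Perm.eq_inv_iff_eq.2 hp), map_one]
  localDiffeo p :=
    let e_inv : Diffeomorph (𝓡 3) (𝓡 3) Sol Sol ∞ := ⟨e⁻¹, he'.contMDiff, he.contMDiff⟩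
    (e_inv.isLocalDiffeomorph p).comp (𝓡 3) L (h.localDiffeo _)
  surjective := h.surjective.comp e⁻¹.surjective
  fibers p q := by
    rw [Function.comp_apply, Function.comp_apply, h.fibers]
    constructor
    · rintro ⟨l, hl, hlp⟩
      exact ⟨_, ⟨l, hl, rfl⟩, (Equiv.Perm.eq_inv_iff_eq (f := e)).1 hlp⟩
    · rintro ⟨_, ⟨l, hl, rfl⟩, hlp⟩
      exact ⟨l, hl, Equiv.Perm.eq_inv_iff_eq.2 hlp⟩

theorem dilate (h : IsSolQuotient Λ π) (r : ℝ) (hr : r ≠ 0) :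
    IsSolQuotient (Λ.map (MulAut.conj (dilation r hr)).toMonoidHom) (π ∘ ⇑(dilation r hr)⁻¹) :=
  h.conj (contDiff_dilation r hr) (by rw [dilation_inv]; exact contDiff_dilation _ _)
    fun l hl => (h.isometry l hl).dilation_conj r hr

theorem exists_abs_mul_le (h : IsSolQuotient Λ π) (c : HomotopyClass L) :
    ∃ M : ℝ, ∀ l, IsDeckOf Λ π c l → ∀ a b, IsHorizontal ⇑(l * l) a b → |a * b| ≤ M := by
  by_cases hex : ∃ l a b, IsDeckOf Λ π c l ∧ IsHorizontal ⇑(l * l) a b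
  · obtain ⟨l, a, b, hl, hab⟩ := hex
    refine ⟨|a * b|, fun l' hl' a' b' hab' => ?_⟩
    obtain ⟨d, hd, rfl⟩ := h.exists_conj_of_isDeckOf hl hl'
    exact ((h.isometry d hd).abs_mul_eq_of_conj (by group) hab hab').ge
  · exact ⟨0, fun l hl a b hab => (hex ⟨l, a, b, hl, hab⟩).elim⟩

theorem exists_abs_mul_le_of_finite (h : IsSolQuotient Λ π) {S : Set (HomotopyClass L)}
    (hS : S.Finite) : ∃ M : ℝ, ∀ c ∈ S, ∀ l, IsDeckOf Λ π c l →
      ∀ a b, IsHorizontal ⇑(l * l) a b → |a * b| ≤ M := by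
  choose M hM using h.exists_abs_mul_le
  obtain ⟨B, hB⟩ := (hS.image M).bddAbove
  exact ⟨B, fun c hc l hl a b hab => (hM c l hl a b hab).trans (hB ⟨c, hc, rfl⟩)⟩

/-- The square is taken in order to discard the isometries reversing the direction of `Z`. -/
theorem exists_isStraight_of_realizes (h : IsSolQuotient Λ π) {r : ℝ} (hr : r ≠ 0)
    {c : HomotopyClass L} {M : ℝ}
    (hM : ∀ l, IsDeckOf Λ π c l → ∀ a b, IsHorizontal ⇑(l * l) a b → |a * b| ≤ M) {γ : ℝ → Sol}
    (hγ : Continuous γ) {T : ℝ} (hc : Realizes (fun t => (π ∘ ⇑(dilation r hr)⁻¹) (γ t)) T c) :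
    ∃ φ : Sol → Sol, IsStraight φ ∧ (∀ t, γ (t + 2 * T) = φ (γ t)) ∧
      ∀ a b, IsHorizontal φ a b → |a * b| ≤ r ^ 2 * M := by
  have hD : Continuous ⇑(dilation r hr)⁻¹ := by
    rw [dilation_inv]
    exact (contDiff_dilation _ _).continuous
  obtain ⟨l, hl, hlγ⟩ := h.exists_isDeckOf (hD.comp hγ) hc
  obtain ⟨φ, hφ⟩ : ∃ φ, φ = dilation r hr * l * (dilation r hr)⁻¹ := ⟨_, rfl⟩
  have hφγ : ∀ t, γ (t + T) = φ (γ t) := fun t => by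
    rw [hφ]
    exact (Equiv.Perm.inv_eq_iff_eq (f := dilation r hr)).1 (hlγ t)
  have hφ_iso : IsSolIsometry φ := hφ ▸ (h.isometry l hl.1).dilation_conj r hr
  refine ⟨⇑(φ * φ), hφ_iso.isStraight_mul_self, fun t => ?_, fun a b hab => ?_⟩
  · rw [two_mul, ← add_assoc, hφγ, hφγ, Equiv.Perm.mul_apply]
  · have hll := hab.dilation_conj r⁻¹ (inv_ne_zero hr)
    rw [← dilation_inv r hr, inv_inv, hφ,
      show ∀ d : Equiv.Perm Sol, d⁻¹ * (d * l * d⁻¹ * (d * l * d⁻¹)) * d = l * l from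
        fun d => by group] at hll
    calc |a * b| = r ^ 2 * |r⁻¹ * a * (r⁻¹ * b)| := by
          rw [← abs_of_nonneg (sq_nonneg r), ← abs_mul]
          congr 1
          field_simp
      _ ≤ r ^ 2 * M := by gcongr; exact hM l hl _ _ hll

theorem exists_isSolQuotient_abs_mul_le (h : IsSolQuotient Λ π) {S : Set (HomotopyClass L)}
    (hS : S.Finite) {ε : ℝ} (hε : 0 < ε) :
    ∃ (Λ' : Subgroup (Equiv.Perm Sol)) (π' : Sol → L), IsSolQuotient Λ' π' ∧
      ∀ c ∈ S, ∀ (γ : ℝ → Sol) (T : ℝ), Continuous γ → Realizes (fun t => π' (γ t)) T c →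
        ∃ φ : Sol → Sol, IsStraight φ ∧ (∀ t, γ (t + 2 * T) = φ (γ t)) ∧
          ∀ a b, IsHorizontal φ a b → |a * b| ≤ ε := by
  obtain ⟨M, hM⟩ := h.exists_abs_mul_le_of_finite hS
  obtain ⟨r, hr, hrM⟩ : ∃ r : ℝ, r ≠ 0 ∧ r ^ 2 * M ≤ ε := by
    refine ⟨√(ε / (|M| + 1)), by positivity, ?_⟩
    rw [Real.sq_sqrt (by positivity), div_mul_eq_mul_div, div_le_iff₀ (by positivity)]
    gcongr
    linarith [le_abs_self M]
  refine ⟨_, _, h.dilate r hr, fun c hc γ T hγ hγc => ?_⟩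
  obtain ⟨φ, hφ, hφγ, hab⟩ := h.exists_isStraight_of_realizes hr (hM c hc) hγ hγc
  exact ⟨φ, hφ, hφγ, fun a b hφ_hor => (hab a b hφ_hor).trans hrM⟩

end IsSolQuotient

end SolGeometry

end

theorem mainTheorem5_general (L : Type*) [TopologicalSpace L]
    [ChartedSpace (EuclideanSpace ℝ (Fin 3)) L] [IsManifold (𝓡 3) ∞ L]
    (hL : SolGeometry.IsSolManifold L)
    (S : Set (SolGeometry.HomotopyClass L)) (hS : S.Finite) :
    ∃ (g : SolGeometry.SmoothMetric L) (Λ : Subgroup (Equiv.Perm SolGeometry.Sol))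
      (π : SolGeometry.Sol → L),
      SolGeometry.IsSolMetric g Λ π ∧
      (∀ c ∈ S, ¬ ∃ (γ : ℝ → SolGeometry.Sol) (T : ℝ),
        SolGeometry.IsTypeC γ ∧ SolGeometry.Realizes (fun t => π (γ t)) T c) ∧
      (∀ c ∈ S, ∀ (γ : ℝ → SolGeometry.Sol) (T : ℝ),
        SolGeometry.IsTypeA γ → SolGeometry.Realizes (fun t => π (γ t)) T c →
          SolGeometry.HasMorseBottIndex γ T 1) := by
  obtain ⟨Λ, π, h⟩ := hL
  obtain ⟨Λ', π', h', hsmall⟩ := h.exists_isSolQuotient_abs_mul_le hS (ε := 1 / 16) (by norm_num)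
  refine ⟨h'.quotientMetric, Λ', π', h'.isSolMetric_quotientMetric, ?_, ?_⟩
  · rintro c hc ⟨γ, T, hγ, hγc⟩
    obtain ⟨φ, hφ, hγφ, hle⟩ := hsmall c hc γ T hγ.1.continuous hγc
    obtain ⟨a, b, hab, hge⟩ := hγ.le_abs_mul hφ (mul_pos two_pos hγc.1) hγφ
    linarith [hle a b hab]
  · intro c hc γ T hγ hγc
    obtain ⟨φ, hφ, hγφ, hle⟩ := hsmall c hc γ T hγ.1.continuous hγc
    obtain ⟨a, b, hab, heq⟩ := hγ.abs_mul_eq hφ hγφ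
    exact hγ.hasMorseBottIndex hγc.1 (by nlinarith [hle a b hab, hγc.1])

theorem mainTheorem5 (L : Type*) [TopologicalSpace L] [T2Space L] [CompactSpace L]
    [ChartedSpace (EuclideanSpace ℝ (Fin 3)) L] [IsManifold (𝓡 3) ∞ L]
    (hL : SolGeometry.IsSolManifold L)
    (S : Set (SolGeometry.HomotopyClass L)) (hS : S.Finite) :
    ∃ (g : SolGeometry.SmoothMetric L) (Λ : Subgroup (Equiv.Perm SolGeometry.Sol))
      (π : SolGeometry.Sol → L),
      SolGeometry.IsSolMetric g Λ π ∧
      (∀ c ∈ S, ¬ ∃ (γ : ℝ → SolGeometry.Sol) (T : ℝ),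
        SolGeometry.IsTypeC γ ∧ SolGeometry.Realizes (fun t => π (γ t)) T c) ∧
      (∀ c ∈ S, ∀ (γ : ℝ → SolGeometry.Sol) (T : ℝ),
        SolGeometry.IsTypeA γ → SolGeometry.Realizes (fun t => π (γ t)) T c →
          SolGeometry.HasMorseBottIndex γ T 1) :=
  mainTheorem5_general L hL S hS
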